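/- **Theorem 3.5.** Let $d\ge 1$ and let $|\cdot|$ be the $1$-norm on $\mathbb{Z}^d$. Let $m_x$, $k_x$ ($x\in\mathbb{Z}^d$) and $\lambda_{x,y}=\lambda_{y,x}$ ($|x-y|=1$) be real random variables on a probability space $(\Omega,\mathbb{P})$, and let $m_{\min},m_{\max},k_{\max},\lambda_{\max}$ be deterministic constants with $m_{\min}>0$ such that, almost surely, $m_{\min}\le m_x\le m_{\max}$ and $0\le k_x\le k_{\max}$ for all $x$, and $0\le\lambda_{x,y}\le\lambda_{\max}$ for all $|x-y|=1$. For an integer $L\ge 1$ let $\Lambda_L=[-L,L]^d\cap\mathbb{Z}^d$, and let $H_L$ be the self-adjoint closure in $L^2(\mathbb{R}^{\Lambda_L})$ of $$\sum_{x\in\Lambda_L}\Big(\frac{1}{2m_x}p_x^2+\frac{k_x}{2}q_x^2\Big)+\sum_{\{x,y\}\subset\Lambda_L,\ |x-y|=1}\lambda_{x,y}(q_x-q_y)^2$$ on the Schwartz space, where $q_x$ is multiplication by the coordinate $q_x$ and $p_x=-i\,\partial/\partial q_x$ (self-adjoint operators). Let $\tau_t(A)=e^{itH_L}Ae^{-itH_L}$.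 Let $h_{0,L}$ be the symmetric matrix indexed by $\Lambda_L$ with diagonal entries $\frac{k_x}{2}+\sum_{u\in\Lambda_L,|u-x|=1}\lambda_{x,u}$, entries $-\lambda_{x,y}$ for $|x-y|=1$, and $0$ otherwise; assume that almost surely $h_{0,L}$ is positive definite for all $L\ge1$. Put $h_L=\mu^{1/2}h_{0,L}\mu^{1/2}$ with the diagonal matrix $\mu=\mathrm{diag}(1/(2m_x))$. For $\alpha\in\mathbb{R}$ and $r>0$ say that $h_L$ has exponentially decaying $(\alpha,r)$-eigenfunction correlators if there are $C<\infty$ and $\eta>0$ such that $$\mathbb{E}\Big(\sup_{u:\mathbb{R}\to\mathbb{C},\ |u|\le 1}\big|\langle\delta_x,h_L^{\alpha}u(h_L)\delta_y\rangle\big|^r\Big)\le Ce^{-\eta|x-y|}\quad\text{for all } L\ge 1 \text{ and } x,y\in\Lambda_L .$$ Products and commutators of unbounded operators are taken on their natural domains ($D([A,B])=D(AB)\cap D(BA)$), and the norm of a densely defined operator $T$ is $\|T\|=\sup\{\|T\psi\|:\psi\in D(T),\|\psi\|\le1\}$; the commutators below are almost surely densely defined. Then: (a) If, for some $r\in(0,1]$,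 $h_L$ has exponentially decaying $(-1/2,r)$-eigenfunction correlators, then there exist $C'<\infty$ and $\mu'>0$ such that $$\mathbb{E}\Big(\sup_{t\in\mathbb{R}}\big\|[\tau_t(q_x),q_y]\big\|^r\Big)\le C'e^{-\mu'|x-y|}\quad\text{for all } L\ge 1 \text{ and } x,y\in\Lambda_L .$$ (b) If $h_L$ has exponentially decaying $(0,1)$-eigenfunction correlators, then there exist $C'<\infty$ and $\mu'>0$ such that $$\mathbb{E}\Big(\sup_{t\in\mathbb{R}}\max\big\{\|[\tau_t(p_x),q_y]\|,\ \|[\tau_t(q_x),p_y]\|,\ \|[\tau_t(p_x),p_y]\|\big\}\Big)\le C'e^{-\mu'|x-y|}\quad\text{for all } L\ge 1 \text{ and } x,y\in\Lambda_L .$$ -/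

import Mathlib

open MeasureTheory SchwartzMap
open scoped ENNReal LineDeriv

noncomputable section

/-! ## Unbounded operators on a complex Hilbert space -/

section Unbounded

variable {H : Type*} [NormedAddCommGroup H] [InnerProductSpace ℂ H]

/-- The product `A B` of two unbounded operators on its natural domain
`{ψ ∈ D(B) : B ψ ∈ D(A)}`. -/
def pmapMul (A B : H →ₗ.[ℂ] H) : H →ₗ.[ℂ] H where
  domain := (A.domain.comap B.toFun).map B.domain.subtype
  toFun :=
    have hB : ∀ ψ : (A.domain.comap B.toFun).map B.domain.subtype, (ψ : H) ∈ B.domain := fun ψ => by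
      obtain ⟨φ, -, h⟩ := ψ.2
      exact h ▸ φ.2
    have hA : ∀ ψ : (A.domain.comap B.toFun).map B.domain.subtype,
        B ⟨ψ, hB ψ⟩ ∈ A.domain := fun ψ => by
      obtain ⟨ψ, φ, hφ, h⟩ := ψ
      subst h
      exact hφ
    { toFun := fun ψ => A ⟨B ⟨ψ, hB ψ⟩, hA ψ⟩
      map_add' := fun ψ φ => by
        rw [← LinearPMap.map_add]
        exact congrArg A (Subtype.ext (LinearPMap.map_add B ⟨ψ, hB ψ⟩ ⟨φ, hB φ⟩))
      map_smul' := fun c ψ => by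
        rw [RingHom.id_apply, ← LinearPMap.map_smul]
        exact congrArg A (Subtype.ext (LinearPMap.map_smul B c ⟨ψ, hB ψ⟩)) }

/-- The commutator `[A, B] = A B - B A` on its natural domain `D(AB) ∩ D(BA)`. -/
def pmapComm (A B : H →ₗ.[ℂ] H) : H →ₗ.[ℂ] H := pmapMul A B - pmapMul B A

open Classical in
/-- The norm of a densely defined operator, `sup {‖T ψ‖ : ψ ∈ D(T), ‖ψ‖ ≤ 1}`, which is the norm
of its bounded extension to the whole space and is `∞` if there is none. An operator
that is not densely defined is given the norm `∞`. -/
def opENorm (T : H →ₗ.[ℂ] H) : ℝ≥0∞ :=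
  if Dense (T.domain : Set H) then ⨆ ψ : T.domain, ⨆ _ : ‖(ψ : H)‖ ≤ 1, ‖T ψ‖ₑ else ∞

/-- `U` is a strongly continuous one-parameter unitary group whose generator is `T`, that is,
`U t = exp (-i t T)` in the sense of Stone's theorem: `ψ ∈ D(T)` and `T ψ = φ` if and only if
`t ↦ U t ψ` is differentiable at `0` with derivative `-i φ`. -/
structure IsUnitaryGroupOf (T : H →ₗ.[ℂ] H) (U : ℝ → H ≃ₗᵢ[ℂ] H) : Prop where
  map_add : ∀ s t, U (s + t) = U s * U t
  continuous : ∀ ψ, Continuous fun t => U t ψ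
  generator : ∀ ψ φ, (ψ, φ) ∈ T.graph ↔ HasDerivAt (fun t => U t ψ) (-(Complex.I • φ)) 0

open Classical in
/-- `expGroup T t = exp (-i t T)`, the unitary group generated by `T`. By Stone's theorem it exists
and is unique for self-adjoint `T`; the value for a `T` that generates no unitary group is
irrelevant. -/
def expGroup (T : H →ₗ.[ℂ] H) : ℝ → H ≃ₗᵢ[ℂ] H :=
  if h : ∃ U, IsUnitaryGroupOf T U then h.choose else fun _ => 1

/-- The Heisenberg evolution `τ_t(A) = exp (i t T) A exp (-i t T)` of an unbounded operator `A`, on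
its natural domain `{ψ : exp (-i t T) ψ ∈ D(A)}`. -/
def heisenberg (T : H →ₗ.[ℂ] H) (t : ℝ) (A : H →ₗ.[ℂ] H) : H →ₗ.[ℂ] H :=
  pmapMul ((expGroup T (-t)).toLinearEquiv.toLinearMap.toPMap ⊤)
    (pmapMul A ((expGroup T t).toLinearEquiv.toLinearMap.toPMap ⊤))

end Unbounded

/-! ## Operators on `L²(ℝ^ι)` given on the Schwartz space -/

section Schwartz

variable (ι : Type*) [Fintype ι]

/-- The Hilbert space `L²(ℝ^ι)`. -/
abbrev L2 : Type _ := Lp ℂ 2 (volume : Measure (EuclideanSpace ℝ ι))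

/-- The Schwartz space of `ℝ^ι`. -/
abbrev Schw : Type _ := 𝓢(EuclideanSpace ℝ ι, ℂ)

/-- The embedding of the Schwartz space into `L²(ℝ^ι)`. -/
def schwToL2 : Schw ι →ₗ[ℂ] L2 ι := (toLpCLM ℂ ℂ 2 volume).toLinearMap

theorem schwToL2_injective : Function.Injective (schwToL2 ι) :=
  injective_toLp 2 volume

variable {ι}

/-- An operator on the Schwartz space as an unbounded operator on `L²(ℝ^ι)`. -/
def coreOp (A : Module.End ℂ (Schw ι)) : L2 ι →ₗ.[ℂ] L2 ι where
  domain := LinearMap.range (schwToL2 ι)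
  toFun := schwToL2 ι ∘ₗ A ∘ₗ
    (LinearEquiv.ofInjective (schwToL2 ι) (schwToL2_injective ι)).symm.toLinearMap

/-- The closure in `L²(ℝ^ι)` of an operator on the Schwartz space. -/
def closedOp (A : Module.End ℂ (Schw ι)) : L2 ι →ₗ.[ℂ] L2 ι := (coreOp A).closure

/-- Multiplication by the coordinate `q_x` on the Schwartz space. -/
def posS (x : ι) : Module.End ℂ (Schw ι) :=
  (smulLeftCLM ℂ (fun q : EuclideanSpace ℝ ι => ((q x : ℝ) : ℂ))).toLinearMap

theorem posS_apply (x : ι) (f : Schw ι) (q : EuclideanSpace ℝ ι) :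
    posS x f q = (q x : ℂ) * f q := by
  have h : Function.HasTemperateGrowth (fun q : EuclideanSpace ℝ ι => ((q x : ℝ) : ℂ)) :=
    (Complex.ofRealCLM.comp (EuclideanSpace.proj x : EuclideanSpace ℝ ι →L[ℝ] ℝ)).hasTemperateGrowth
  exact smulLeftCLM_apply_apply h f q

open Classical in
/-- `-i ∂/∂q_x` on the Schwartz space. -/
def momS (x : ι) : Module.End ℂ (Schw ι) :=
  (-Complex.I) •
    (LineDeriv.lineDerivOpCLM ℂ (Schw ι) (EuclideanSpace.single x (1 : ℝ))).toLinearMap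

/-- The self-adjoint position operator `q_x` on `L²(ℝ^ι)`. -/
def posOp (x : ι) : L2 ι →ₗ.[ℂ] L2 ι := closedOp (posS x)

/-- The self-adjoint momentum operator `p_x` on `L²(ℝ^ι)`. -/
def momOp (x : ι) : L2 ι →ₗ.[ℂ] L2 ι := closedOp (momS x)

end Schwartz

/-! ## Functional calculus of real symmetric matrices -/

/-- `φ(A) = O φ(D) Oᵀ` for a real symmetric matrix `A = O D Oᵀ`, with `O` orthogonal and `D`
diagonal, and an arbitrary `φ : ℝ → ℂ`. -/
def matFun {n : Type*} [Fintype n] [DecidableEq n] {A : Matrix n n ℝ} (hA : A.IsHermitian)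
    (φ : ℝ → ℂ) : Matrix n n ℂ :=
  (hA.eigenvectorUnitary : Matrix n n ℝ).map Complex.ofReal *
    Matrix.diagonal (fun j => φ (hA.eigenvalues j)) *
    ((hA.eigenvectorUnitary : Matrix n n ℝ).transpose).map Complex.ofReal

/-! ## The oscillator system -/

/-- The `1`-norm distance `|x - y|` on `ℤ^d`. -/
def dist1 {d : ℕ} (x y : Fin d → ℤ) : ℤ := ∑ i, |x i - y i|

/-- The cube `Λ_L = [-L, L]^d ∩ ℤ^d`. -/
def box (d L : ℕ) : Finset (Fin d → ℤ) :=
  Finset.Icc (fun _ => -(L : ℤ)) (fun _ => (L : ℤ))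

/-- Masses, spring constants and couplings; a coupling is attached to an unordered pair of sites, and
only the pairs at distance one matter. -/
structure OscParams (d : ℕ) where
  m : (Fin d → ℤ) → ℝ
  k : (Fin d → ℤ) → ℝ
  lam : Sym2 (Fin d → ℤ) → ℝ

namespace OscParams

variable {d : ℕ} (p : OscParams d)

/-- The bounds on the parameters. -/
structure Bounded (mmin mmax kmax lammax : ℝ) : Prop where
  m_mem : ∀ x, p.m x ∈ Set.Icc mmin mmax
  k_mem : ∀ x, p.k x ∈ Set.Icc 0 kmax
  lam_mem : ∀ x y, dist1 x y = 1 → p.lam s(x, y) ∈ Set.Icc 0 lammax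

/-- The many-body Hamiltonian
`∑_x (p_x² / (2 m_x) + (k_x / 2) q_x²) + ∑_{{x,y}, |x-y|=1} λ_{x,y} (q_x - q_y)²`
on the Schwartz space; the sum over undirected edges is half of the sum over ordered pairs. -/
def hamS (L : ℕ) : Module.End ℂ (Schw (box d L)) :=
  ∑ x : box d L, (((1 / (2 * p.m x) : ℝ) : ℂ) • momS x ^ 2 + ((p.k x / 2 : ℝ) : ℂ) • posS x ^ 2) +
    (1 / 2 : ℂ) • ∑ x : box d L, ∑ y : box d L,
      if dist1 (x : Fin d → ℤ) y = 1 then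
        ((p.lam s((x : Fin d → ℤ), y) : ℝ) : ℂ) • (posS x - posS y) ^ 2
      else 0

/-- The self-adjoint Hamiltonian `H_L` on `L²(ℝ^{Λ_L})`. -/
def ham (L : ℕ) : L2 (box d L) →ₗ.[ℂ] L2 (box d L) := closedOp (p.hamS L)

/-- The matrix `h_{0,L}`. -/
def h0 (L : ℕ) : Matrix (box d L) (box d L) ℝ := fun x y =>
  if x = y then
    p.k x / 2 + ∑ u : box d L,
      if dist1 (u : Fin d → ℤ) x = 1 then p.lam s((x : Fin d → ℤ), u) else 0
  else if dist1 (x : Fin d → ℤ) y = 1 then -p.lam s((x : Fin d → ℤ), y)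
  else 0

/-- The diagonal matrix `μ^{1/2}`, where `μ_{x,x} = 1 / (2 m_x)`. -/
def sqrtMu (L : ℕ) : Matrix (box d L) (box d L) ℝ :=
  Matrix.diagonal fun x => Real.sqrt (1 / (2 * p.m x))

/-- The one-particle Hamiltonian `h_L = μ^{1/2} h_{0,L} μ^{1/2}`. -/
def h (L : ℕ) : Matrix (box d L) (box d L) ℝ := p.sqrtMu L * p.h0 L * p.sqrtMu L

theorem h0_isHermitian (L : ℕ) : (p.h0 L).IsHermitian := by
  ext x y
  have hs : dist1 (y : Fin d → ℤ) x = dist1 (x : Fin d → ℤ) y := by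
    simp [dist1, abs_sub_comm]
  by_cases hxy : x = y
  · subst hxy; rfl
  · simp [h0, Matrix.conjTranspose_apply, hxy, Ne.symm hxy, hs, Sym2.eq_swap]

theorem h_isHermitian (L : ℕ) : (p.h L).IsHermitian := by
  have h1 : (p.sqrtMu L).conjTranspose = p.sqrtMu L := by simp [sqrtMu]
  have h2 := Matrix.isHermitian_mul_mul_conjTranspose (p.sqrtMu L) (p.h0_isHermitian L)
  rwa [h1] at h2

/-- `sup_{|u| ≤ 1} |⟨δ_x, h_L^α u(h_L) δ_y⟩|^r`, the supremum being over all functions `u : ℝ → ℂ`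
with `|u| ≤ 1`. -/
def correlator (α r : ℝ) (L : ℕ) (x y : box d L) : ℝ≥0∞ :=
  ⨆ u : ℝ → ℂ, ⨆ _ : ∀ s, ‖u s‖ ≤ 1,
    ‖matFun (p.h_isHermitian L) (fun s => ((s ^ α : ℝ) : ℂ) * u s) x y‖ₑ ^ r

/-- `‖[τ_t(A), B]‖` for the dynamics `τ_t` generated by `H_L`. -/
def commNorm (L : ℕ) (t : ℝ) (A B : L2 (box d L) →ₗ.[ℂ] L2 (box d L)) : ℝ≥0∞ :=
  opENorm (pmapComm (heisenberg (p.ham L) t A) B)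

end OscParams

/-- A family `F ω L x y` of random quantities is exponentially decaying in mean, with constants
`C < ∞`, `μ > 0` independent of `L ≥ 1` and of `x, y ∈ Λ_L`. -/
def ExpDecayInMean {Ω : Type*} [MeasurableSpace Ω] (P : Measure Ω) {d : ℕ}
    (F : Ω → (L : ℕ) → box d L → box d L → ℝ≥0∞) : Prop :=
  ∃ C μ : ℝ, 0 < μ ∧ ∀ L : ℕ, 1 ≤ L → ∀ x y : box d L,
    ∫⁻ ω, F ω L x y ∂P ≤ ENNReal.ofReal (C * Real.exp (-μ * dist1 (x : Fin d → ℤ) y))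

end

/-!
The Hamiltonian is quadratic: if `O` diagonalizes `h_L` with eigenvalues `ω_j²`, then in the normal
modes `Q_j = ∑_x O_{x,j} μ_x^{-1/2} q_x` and `P_j = ∑_x O_{x,j} μ_x^{1/2} p_x` it reads
`∑_j (P_j² + ω_j² Q_j²)`. The Fock states, obtained from the Gaussian ground state by applying
creation operators, are eigenvectors with dense span, so `H_L` generates a unitary group that can be
written down on them, and there `τ_t` acts on the `Q_j` and `P_j` by the classical rotation
`Q_j ↦ cos(2tω_j) Q_j + ω_j⁻¹ sin(2tω_j) P_j`. By the canonical commutation relations each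
commutator is then, up to a phase, the scalar `c ⟨δ_x, φ(h_L^{1/2}) δ_y⟩` on a dense domain, where
`φ(w)` is `w⁻¹ sin(2tw)`, `cos(2tw)` or `w sin(2tw)` and `c` is controlled by the bounds on the
masses. These matrix elements are dominated, uniformly in `t`, by the correlators with `α = -1/2`
in the first case and `α = 0` in the others; in the last case the factor `w` is absorbed by a bound
on the spectrum of `h_L` uniform in `L`.
-/

/-! ## Operators on the Schwartz space -/

section SchwartzOperators

variable {ι : Type*} [Fintype ι]

/-- The operators `A` and `B` on the Schwartz space are formally adjoint to each other with respect
to the `L²` inner product. -/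
def FormalAdj (A B : Module.End ℂ (Schw ι)) : Prop :=
  ∀ f g, inner ℂ (schwToL2 ι (A f)) (schwToL2 ι g) = inner ℂ (schwToL2 ι f) (schwToL2 ι (B g))

theorem FormalAdj.symm {A B : Module.End ℂ (Schw ι)} (h : FormalAdj A B) : FormalAdj B A :=
  fun f g => by
    rw [← inner_conj_symm, ← h g f, inner_conj_symm]

theorem FormalAdj.add {A B A' B' : Module.End ℂ (Schw ι)} (h : FormalAdj A B)
    (h' : FormalAdj A' B') : FormalAdj (A + A') (B + B') := fun f g => by
  simp only [LinearMap.add_apply, map_add, inner_add_left, inner_add_right, h f g, h' f g]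

theorem FormalAdj.smul {A B : Module.End ℂ (Schw ι)} (h : FormalAdj A B) (c : ℂ) :
    FormalAdj (c • A) ((starRingEnd ℂ) c • B) := fun f g => by
  simp only [LinearMap.smul_apply, map_smul, inner_smul_left, inner_smul_right, h f g]

theorem FormalAdj.ofReal_smul {A B : Module.End ℂ (Schw ι)} (h : FormalAdj A B) (c : ℝ) :
    FormalAdj ((c : ℂ) • A) ((c : ℂ) • B) := by
  simpa only [Complex.conj_ofReal] using h.smul (c : ℂ)

theorem FormalAdj.mul {A B A' B' : Module.End ℂ (Schw ι)} (h : FormalAdj A B)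
    (h' : FormalAdj A' B') : FormalAdj (A * A') (B' * B) := fun f g => by
  simp only [Module.End.mul_apply, h _ g, h' f]

theorem FormalAdj.sum {κ : Type*} (s : Finset κ) {A B : κ → Module.End ℂ (Schw ι)}
    (h : ∀ i ∈ s, FormalAdj (A i) (B i)) : FormalAdj (∑ i ∈ s, A i) (∑ i ∈ s, B i) := fun f g => by
  simp only [LinearMap.sum_apply, map_sum, sum_inner, inner_sum]
  exact Finset.sum_congr rfl fun i hi => h i hi f g

theorem inner_schwToL2 (f g : Schw ι) :
    inner ℂ (schwToL2 ι f) (schwToL2 ι g) = ∫ q, inner ℂ (f q) (g q) :=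
  inner_toL2_toL2_eq f g

theorem formalAdj_posS (x : ι) : FormalAdj (posS x) (posS x) := fun f g => by
  rw [inner_schwToL2, inner_schwToL2]
  congr 1 with q
  simp only [posS_apply, RCLike.inner_apply, map_mul, Complex.conj_ofReal]
  ring

theorem momS_apply [DecidableEq ι] (x : ι) (f : Schw ι) (q : EuclideanSpace ℝ ι) :
    momS x f q = -Complex.I * fderiv ℝ f q (EuclideanSpace.single x (1 : ℝ)) := by
  rw [momS, LinearMap.smul_apply, smul_apply, smul_eq_mul]
  congr 1
  rw [ContinuousLinearMap.coe_coe, LineDeriv.lineDerivOpCLM_apply, lineDerivOp_apply_eq_fderiv]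
  congr!

theorem formalAdj_momS (x : ι) : FormalAdj (momS x) (momS x) := fun f g => by
  classical
  rw [inner_schwToL2, inner_schwToL2]
  set e := EuclideanSpace.single x (1 : ℝ)
  have hparts : ∫ q, inner ℂ (f q) (∂_{e} g q) = -∫ q, inner ℂ (∂_{e} f q) (g q) := by
    simpa [RCLike.inner_apply, mul_comm] using
      integral_bilinear_lineDerivOp_right_eq_neg_left (μ := volume) f g
        ((ContinuousLinearMap.mul ℝ ℂ).comp (Complex.conjCLE : ℂ →L[ℝ] ℂ)) e
  have hg (q) : inner ℂ (f q) (momS x g q) = -Complex.I * inner ℂ (f q) (∂_{e} g q) := by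
    rw [momS_apply, lineDerivOp_apply_eq_fderiv]
    simp only [RCLike.inner_apply]
    ring
  have hf (q) : inner ℂ (momS x f q) (g q) = Complex.I * inner ℂ (∂_{e} f q) (g q) := by
    rw [momS_apply, lineDerivOp_apply_eq_fderiv]
    simp only [RCLike.inner_apply, map_mul, map_neg, Complex.conj_I]
    ring
  simp only [hf, hg, integral_const_mul, hparts]
  ring

/-! ### Closures of symmetric operators -/

theorem dense_range_schwToL2 : Dense (LinearMap.range (schwToL2 ι) : Set (L2 ι)) :=
  denseRange_toLpCLM (p := 2) (by simp)

theorem mem_graph_coreOp (A : Module.End ℂ (Schw ι)) (f : Schw ι) :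
    (schwToL2 ι f, schwToL2 ι (A f)) ∈ (coreOp A).graph := by
  rw [LinearPMap.mem_graph_iff]
  refine ⟨⟨schwToL2 ι f, LinearMap.mem_range_self _ f⟩, rfl, ?_⟩
  change schwToL2 ι (A ((LinearEquiv.ofInjective (schwToL2 ι) (schwToL2_injective ι)).symm
    (LinearEquiv.ofInjective (schwToL2 ι) (schwToL2_injective ι) f))) = _
  rw [LinearEquiv.symm_apply_apply]

theorem mem_graph_coreOp_iff (A : Module.End ℂ (Schw ι)) (z : L2 ι × L2 ι) :
    z ∈ (coreOp A).graph ↔ ∃ f, (schwToL2 ι f, schwToL2 ι (A f)) = z := by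
  refine ⟨fun hz => ?_, ?_⟩
  · obtain ⟨⟨_, f, rfl⟩, hfst, -⟩ := (LinearPMap.mem_graph_iff _).1 hz
    exact ⟨f, Prod.ext hfst
      ((coreOp A).mem_graph_snd_inj' (mem_graph_coreOp A f) hz hfst)⟩
  · rintro ⟨f, rfl⟩
    exact mem_graph_coreOp A f

variable {A : Module.End ℂ (Schw ι)}

theorem FormalAdj.isClosable {B : Module.End ℂ (Schw ι)} (h : FormalAdj A B) :
    (coreOp A).IsClosable := by
  have hd : Dense ((coreOp B).domain : Set (L2 ι)) := dense_range_schwToL2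
  have hfa : (coreOp B).IsFormalAdjoint (coreOp A) := by
    intro ψ φ
    obtain ⟨f, hf⟩ : ∃ f, schwToL2 ι f = ψ := ψ.2
    obtain ⟨g, hg⟩ : ∃ g, schwToL2 ι g = φ := φ.2
    rw [(coreOp B).mem_graph_snd_inj ((coreOp B).mem_graph ψ) (mem_graph_coreOp B f) hf.symm,
      (coreOp A).mem_graph_snd_inj ((coreOp A).mem_graph φ) (mem_graph_coreOp A g) hg.symm,
      ← hf, ← hg]
    exact h.symm f g
  exact ((LinearPMap.adjoint_isClosed hd).isClosable).leIsClosable (hfa.le_adjoint hd)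

theorem FormalAdj.mem_graph_closedOp_iff {B : Module.End ℂ (Schw ι)} (h : FormalAdj A B)
    (z : L2 ι × L2 ι) :
    z ∈ (closedOp A).graph ↔
      z ∈ _root_.closure (Set.range fun f => (schwToL2 ι f, schwToL2 ι (A f))) := by
  rw [closedOp, ← h.isClosable.graph_closure_eq_closure_graph, ← SetLike.mem_coe,
    Submodule.topologicalClosure_coe]
  suffices ((coreOp A).graph : Set (L2 ι × L2 ι)) =
      Set.range fun f => (schwToL2 ι f, schwToL2 ι (A f)) by rw [this]
  exact Set.ext (mem_graph_coreOp_iff A)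

theorem mem_graph_closedOp (A : Module.End ℂ (Schw ι)) (f : Schw ι) :
    (schwToL2 ι f, schwToL2 ι (A f)) ∈ (closedOp A).graph :=
  LinearPMap.le_graph_of_le (LinearPMap.le_closure _) (mem_graph_coreOp A f)

theorem FormalAdj.inner_of_mem_graph {B : Module.End ℂ (Schw ι)} (h : FormalAdj A B)
    {ψ φ : L2 ι} (hz : (ψ, φ) ∈ (closedOp A).graph) (f : Schw ι) :
    inner ℂ (schwToL2 ι f) φ = inner ℂ (schwToL2 ι (B f)) ψ := by
  rw [h.mem_graph_closedOp_iff] at hz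
  have hc : IsClosed {z : L2 ι × L2 ι |
      inner ℂ (schwToL2 ι f) z.2 = inner ℂ (schwToL2 ι (B f)) z.1} :=
    isClosed_eq (by fun_prop) (by fun_prop)
  refine closure_minimal ?_ hc hz
  rintro _ ⟨g, rfl⟩
  exact (h.symm f g).symm

end SchwartzOperators

/-! ## Unitary groups that are diagonal in a Hilbert basis -/

section DiagonalGroup

open Filter Topology

variable {H κ : Type*} [NormedAddCommGroup H] [InnerProductSpace ℂ H]

theorem orthonormal_circle_smul {v : κ → H} (hv : Orthonormal ℂ v) (c : κ → Circle) :
    Orthonormal ℂ fun i => c i • v i :=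
  ⟨fun i => by rw [Circle.norm_smul, hv.1 i], fun i j hij => by
    simp only [Circle.smul_def, inner_smul_left, inner_smul_right, hv.2 hij, mul_zero]⟩

theorem span_range_circle_smul (v : κ → H) (c : κ → Circle) :
    Submodule.span ℂ (Set.range fun i => c i • v i) = Submodule.span ℂ (Set.range v) := by
  refine le_antisymm (Submodule.span_le.2 ?_) (Submodule.span_le.2 ?_) <;> rintro _ ⟨i, rfl⟩
  · exact Submodule.smul_mem _ (c i : ℂ) (Submodule.subset_span ⟨i, rfl⟩)
  · rw [← inv_smul_smul (c i) (v i)]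
    exact Submodule.smul_mem _ ((c i)⁻¹ : Circle).1 (Submodule.subset_span ⟨i, rfl⟩)

variable (b : HilbertBasis κ ℂ H)

theorem ext_repr {v w : H} (h : ∀ i, b.repr v i = b.repr w i) : v = w :=
  b.repr.injective (lp.ext (funext h))

theorem hasSum_norm_sq_repr (v : H) : HasSum (fun i => ‖b.repr v i‖ ^ 2) (‖v‖ ^ 2) := by
  simpa [LinearIsometryEquiv.norm_map] using lp.hasSum_norm (p := 2) (by simp) (b.repr v)

theorem tendsto_zero_of_repr_dominated {α : Type*} {l : Filter α} {v : α → H} {w : H} {C : ℝ}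
    (hb : ∀ᶠ a in l, ∀ i, ‖b.repr (v a) i‖ ≤ C * ‖b.repr w i‖)
    (hv : ∀ i, Tendsto (fun a => b.repr (v a) i) l (𝓝 0)) : Tendsto v l (𝓝 0) := by
  have hsq : Tendsto (fun a => ‖v a‖ ^ 2) l (𝓝 0) := by
    have h := tendsto_tsum_of_dominated_convergence (𝓕 := l)
      (f := fun a i => ‖b.repr (v a) i‖ ^ 2) (g := fun _ => (0 : ℝ))
      (bound := fun i => C ^ 2 * ‖b.repr w i‖ ^ 2)
      ((hasSum_norm_sq_repr b w).summable.mul_left _) (fun i => by simpa using (hv i).norm.pow 2)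
      (hb.mono fun a ha i => by
        rw [norm_pow, norm_norm, ← mul_pow]
        exact pow_le_pow_left₀ (norm_nonneg _) (ha i) 2)
    simpa [(hasSum_norm_sq_repr b _).tsum_eq] using h
  rw [tendsto_zero_iff_norm_tendsto_zero]
  simpa using ((Real.continuous_sqrt.tendsto 0).comp hsq).congr fun a => by simp

variable [CompleteSpace H]

/-- The unitary operator that multiplies the `i`-th coordinate in the basis `b` by the phase
`c i`. -/
noncomputable def diagonalUnitary (c : κ → Circle) : H ≃ₗᵢ[ℂ] H :=
  b.repr.trans (HilbertBasis.mk (orthonormal_circle_smul b.orthonormal c)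
    (by rw [span_range_circle_smul, b.dense_span])).repr.symm

theorem repr_diagonalUnitary (c : κ → Circle) (v : H) (i : κ) :
    b.repr (diagonalUnitary b c v) i = c i * b.repr v i := by
  have hsp : ⊤ ≤ (Submodule.span ℂ (Set.range fun i => c i • b i)).topologicalClosure := by
    rw [span_range_circle_smul, b.dense_span]
  have hb' := HilbertBasis.coe_mk (orthonormal_circle_smul b.orthonormal c) hsp
  set b' := HilbertBasis.mk (orthonormal_circle_smul b.orthonormal c) hsp
  have h : b'.repr (diagonalUnitary b c v) i = b.repr v i :=
    congrArg (fun w : lp (fun _ : κ => ℂ) 2 => w i) (b'.repr.apply_symm_apply (b.repr v))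
  rw [b'.repr_apply_apply, congrFun hb' i, Circle.smul_def, inner_smul_left,
    ← Circle.coe_inv_eq_conj, Circle.coe_inv] at h
  rw [b.repr_apply_apply, ← h, mul_inv_cancel_left₀ (Circle.coe_ne_zero _)]

/-- The one-parameter unitary group `exp (-i t T)` of the self-adjoint operator `T` with
`T (b i) = E i • b i`. -/
noncomputable def diagonalGroup (E : κ → ℝ) (t : ℝ) : H ≃ₗᵢ[ℂ] H :=
  diagonalUnitary b fun i => Circle.exp (-(t * E i))

variable (E : κ → ℝ)

theorem repr_diagonalGroup (t : ℝ) (v : H) (i : κ) :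
    b.repr (diagonalGroup b E t v) i = Circle.exp (-(t * E i)) * b.repr v i :=
  repr_diagonalUnitary b _ v i

theorem diagonalGroup_zero (v : H) : diagonalGroup b E 0 v = v :=
  ext_repr b fun i => by simp [repr_diagonalGroup]

theorem diagonalGroup_add (s t : ℝ) :
    diagonalGroup b E (s + t) = diagonalGroup b E s * diagonalGroup b E t := by
  refine LinearIsometryEquiv.ext fun v => ext_repr b fun i => ?_
  rw [LinearIsometryEquiv.coe_mul, Function.comp_apply, repr_diagonalGroup, repr_diagonalGroup,
    repr_diagonalGroup, add_mul, neg_add, Circle.exp_add, Circle.coe_mul, mul_assoc]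

theorem continuous_diagonalGroup (ψ : H) : Continuous fun t => diagonalGroup b E t ψ := by
  refine continuous_iff_continuousAt.2 fun t => ?_
  rw [ContinuousAt, ← tendsto_sub_nhds_zero_iff]
  refine tendsto_zero_of_repr_dominated b (w := ψ) (C := 2) (.of_forall fun s i => ?_) fun i => ?_
  · rw [map_sub, lp.coeFn_sub, Pi.sub_apply, two_mul]
    refine (norm_sub_le _ _).trans_eq ?_
    rw [repr_diagonalGroup, repr_diagonalGroup, norm_mul, norm_mul, Circle.norm_coe,
      Circle.norm_coe, one_mul]
  · simp only [map_sub, lp.coeFn_sub, Pi.sub_apply, repr_diagonalGroup]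
    have hcont : Continuous fun s : ℝ => (Circle.exp (-(s * E i)) : ℂ) * b.repr ψ i -
        Circle.exp (-(t * E i)) * b.repr ψ i := by fun_prop
    simpa using hcont.tendsto t

theorem hasDerivAt_circleExp_neg_mul (e : ℝ) :
    HasDerivAt (fun t : ℝ => (Circle.exp (-(t * e)) : ℂ)) (-(Complex.I * e)) 0 := by
  have h : HasDerivAt (fun t : ℝ => ((-(t * e) : ℝ) : ℂ) * Complex.I)
      (((-(1 * e) : ℝ) : ℂ) * Complex.I) 0 :=
    (((hasDerivAt_id (0 : ℝ)).mul_const e).neg.ofReal_comp).mul_const _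
  exact h.cexp.congr_deriv (by simp [mul_comm])

theorem norm_circleExp_sub_one_le (s : ℝ) : ‖(Circle.exp s : ℂ) - 1‖ ≤ |s| := by
  rw [Circle.coe_exp, mul_comm]
  exact Real.norm_exp_I_mul_ofReal_sub_one_le

theorem repr_slope_diagonalGroup (ψ : H) (t : ℝ) (i : κ) :
    b.repr (t⁻¹ • (diagonalGroup b E t ψ - ψ)) i =
      t⁻¹ • ((Circle.exp (-(t * E i)) - 1) * b.repr ψ i) := by
  rw [← Complex.coe_smul, ← Complex.coe_smul, map_smul, map_sub, lp.coeFn_smul, lp.coeFn_sub,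
    Pi.smul_apply, Pi.sub_apply, repr_diagonalGroup, sub_mul, one_mul]

theorem norm_repr_slope_diagonalGroup_le (ψ : H) (t : ℝ) (i : κ) :
    ‖b.repr (t⁻¹ • (diagonalGroup b E t ψ - ψ)) i‖ ≤ ‖(E i : ℂ) * b.repr ψ i‖ := by
  rw [repr_slope_diagonalGroup, norm_smul, norm_mul, norm_mul, ← mul_assoc, norm_inv,
    Real.norm_eq_abs]
  refine mul_le_mul_of_nonneg_right ?_ (norm_nonneg _)
  calc |t|⁻¹ * ‖(Circle.exp (-(t * E i)) : ℂ) - 1‖ ≤ |t|⁻¹ * |-(t * E i)| := by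
        gcongr; exact norm_circleExp_sub_one_le _
    _ = (|t|⁻¹ * |t|) * |E i| := by rw [abs_neg, abs_mul, mul_assoc]
    _ ≤ ‖(E i : ℂ)‖ := by
        rw [Complex.norm_real, Real.norm_eq_abs]
        exact mul_le_of_le_one_left (abs_nonneg _) inv_mul_le_one

variable {b E}

theorem repr_of_hasDerivAt_diagonalGroup {ψ φ : H}
    (h : HasDerivAt (fun t => diagonalGroup b E t ψ) (-(Complex.I • φ)) 0) (i : κ) :
    b.repr φ i = E i * b.repr ψ i := by
  have h₁ := ((innerSL ℂ (b i)).restrictScalars ℝ).hasFDerivAt.comp_hasDerivAt (0 : ℝ) h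
  have h₂ := (hasDerivAt_circleExp_neg_mul (E i)).mul_const (b.repr ψ i)
  have hcoord : (fun t : ℝ => (Circle.exp (-(t * E i)) : ℂ) * b.repr ψ i) =
      (innerSL ℂ (b i)).restrictScalars ℝ ∘ fun t => diagonalGroup b E t ψ := by
    ext t
    rw [← repr_diagonalGroup, b.repr_apply_apply]
    rfl
  rw [hcoord] at h₂
  have hderiv := h₁.unique h₂
  simp only [ContinuousLinearMap.coe_restrictScalars', innerSL_apply_apply, inner_neg_right,
    inner_smul_right, neg_mul, neg_inj, mul_assoc] at hderiv
  rw [← b.repr_apply_apply] at hderiv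
  exact mul_left_cancel₀ Complex.I_ne_zero hderiv

theorem hasDerivAt_diagonalGroup {ψ φ : H} (h : ∀ i, b.repr φ i = E i * b.repr ψ i) :
    HasDerivAt (fun t => diagonalGroup b E t ψ) (-(Complex.I • φ)) 0 := by
  rw [hasDerivAt_iff_tendsto_slope_zero, ← tendsto_sub_nhds_zero_iff]
  simp only [zero_add, diagonalGroup_zero]
  have hI (i : κ) : b.repr (-(Complex.I • φ)) i = -(Complex.I * E i) * b.repr ψ i := by
    rw [map_neg, map_smul, lp.coeFn_neg, lp.coeFn_smul, Pi.neg_apply, Pi.smul_apply, h i,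
      smul_eq_mul, neg_mul, mul_assoc]
  refine tendsto_zero_of_repr_dominated b (w := φ) (C := 2) (.of_forall fun t i => ?_) fun i => ?_
  · rw [map_sub, lp.coeFn_sub, Pi.sub_apply, two_mul]
    refine (norm_sub_le _ _).trans (add_le_add ?_ (le_of_eq ?_))
    · exact (norm_repr_slope_diagonalGroup_le b E ψ t i).trans_eq (by rw [h i])
    · rw [hI, neg_mul, norm_neg, mul_assoc, norm_mul, Complex.norm_I, one_mul, h i]
  · have hslope := hasDerivAt_iff_tendsto_slope_zero.1
      ((hasDerivAt_circleExp_neg_mul (E i)).mul_const (b.repr ψ i))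
    refine (tendsto_sub_nhds_zero_iff.2 hslope).congr fun t => ?_
    rw [map_sub, lp.coeFn_sub, Pi.sub_apply, repr_slope_diagonalGroup, hI]
    simp [sub_mul]

end DiagonalGroup

section EigenbasisGroup

theorem FormalAdj.isUnitaryGroupOf_diagonalGroup {ι κ : Type*} [Fintype ι]
    {A : Module.End ℂ (Schw ι)} (hA : FormalAdj A A) (b : HilbertBasis κ ℂ (L2 ι))
    (e : κ → Schw ι) (hb : ∀ i, b i = schwToL2 ι (e i)) (E : κ → ℝ)
    (hE : ∀ i, A (e i) = (E i : ℂ) • e i) :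
    IsUnitaryGroupOf (closedOp A) (diagonalGroup b E) := by
  refine ⟨diagonalGroup_add b E, continuous_diagonalGroup b E, fun ψ φ =>
    ⟨fun h => hasDerivAt_diagonalGroup fun i => ?_, fun h => ?_⟩⟩
  · rw [b.repr_apply_apply, b.repr_apply_apply, hb, hA.inner_of_mem_graph h, hE, map_smul,
      inner_smul_left, Complex.conj_ofReal]
  · rw [hA.mem_graph_closedOp_iff]
    refine mem_closure_of_tendsto ((b.hasSum_repr ψ).prodMk_nhds (b.hasSum_repr φ))
      (.of_forall fun s => ⟨∑ i ∈ s, b.repr ψ i • e i, ?_⟩)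
    simp only [map_sum, map_smul, hE, repr_of_hasDerivAt_diagonalGroup h, hb, smul_smul, mul_comm]

namespace IsUnitaryGroupOf

variable {H : Type*} [NormedAddCommGroup H] [InnerProductSpace ℂ H] {T : H →ₗ.[ℂ] H}
  {U : ℝ → H ≃ₗᵢ[ℂ] H}

theorem map_zero (hU : IsUnitaryGroupOf T U) : U 0 = 1 := by
  have h := hU.map_add 0 0
  rw [add_zero] at h
  exact mul_eq_left.1 h.symm

theorem hasDerivAt (hU : IsUnitaryGroupOf T U) {ψ φ : H} (h : (ψ, φ) ∈ T.graph) (t : ℝ) :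
    HasDerivAt (fun t => U t ψ) (-(Complex.I • U t φ)) t := by
  have h₀ := (((U t).toContinuousLinearEquiv : H →L[ℂ] H).restrictScalars ℝ).hasFDerivAt
    |>.comp_hasDerivAt (0 : ℝ) ((hU.generator _ _).1 h)
  have hshift : HasDerivAt (fun s => U (t + s) ψ) (-(Complex.I • U t φ)) 0 := by
    convert h₀ using 1
    · ext s
      simp [hU.map_add]
    · change _ = U t (-(Complex.I • φ))
      rw [map_neg, map_smul]
  simpa using HasDerivAt.comp_sub_const (f := fun s => U (t + s) ψ) t t (by simpa using hshift)

theorem apply_eigenvector (hU : IsUnitaryGroupOf T U) {ψ : H} {E : ℝ}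
    (h : (ψ, (E : ℂ) • ψ) ∈ T.graph) (t : ℝ) :
    U t ψ = Complex.exp (-(Complex.I * (t * E))) • ψ := by
  have hconst (t : ℝ) :
      HasDerivAt (fun t : ℝ => Complex.exp (Complex.I * (t * E)) • U t ψ) 0 t := by
    have hphase : HasDerivAt (fun t : ℝ => Complex.I * ((t : ℂ) * E)) (Complex.I * (1 * E)) t :=
      (Complex.ofRealCLM.hasDerivAt.mul_const _).const_mul _
    refine (hphase.cexp.smul (hU.hasDerivAt h t)).congr_deriv ?_
    rw [map_smul, smul_neg, smul_smul, smul_smul, one_mul, mul_assoc, neg_add_cancel]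
  have heq := is_const_of_deriv_eq_zero (fun t => (hconst t).differentiableAt)
    (fun t => (hconst t).deriv) t 0
  simp only [hU.map_zero, Complex.ofReal_zero, zero_mul, mul_zero, Complex.exp_zero, one_smul,
    LinearIsometryEquiv.coe_one, id_eq] at heq
  rw [← heq, smul_smul, ← Complex.exp_add, neg_add_cancel, Complex.exp_zero, one_smul, heq]

end IsUnitaryGroupOf

end EigenbasisGroup

/-! ## Completeness of polynomials times a Gaussian -/

section Gaussian

open scoped ContDiff Nat

theorem mul_sub_mul_sq_le {c : ℝ} (hc : 0 < c) (a s : ℝ) : a * s - c * s ^ 2 ≤ a ^ 2 / (4 * c) := by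
  rw [le_div_iff₀ (by positivity)]
  nlinarith [sq_nonneg (a - 2 * c * s)]

theorem exists_one_add_pow_mul_exp_neg_le {c : ℝ} (hc : 0 < c) (N : ℕ) :
    ∃ K : ℝ, ∀ s : ℝ, 0 ≤ s → (1 + s) ^ N * Real.exp (-(c * s ^ 2)) ≤ K := by
  refine ⟨N ! * Real.exp (1 + 1 ^ 2 / (4 * c)), fun s hs => ?_⟩
  have hpow : (1 + s) ^ N ≤ N ! * Real.exp (1 + s) := by
    have h := Real.pow_div_factorial_le_exp (1 + s) (by linarith) N
    rwa [div_le_iff₀ (by positivity), mul_comm] at h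
  calc (1 + s) ^ N * Real.exp (-(c * s ^ 2))
      ≤ N ! * Real.exp (1 + s) * Real.exp (-(c * s ^ 2)) := by gcongr
    _ = N ! * Real.exp (1 + (1 * s - c * s ^ 2)) := by
        rw [mul_assoc, ← Real.exp_add]; ring_nf
    _ ≤ N ! * Real.exp (1 + 1 ^ 2 / (4 * c)) := by
        gcongr
        exact mul_sub_mul_sq_le hc 1 s

variable {E : Type*} [NormedAddCommGroup E]

theorem exists_norm_iteratedFDeriv_exp_neg_le [NormedSpace ℝ E] {g : E → ℝ}
    (hg : g.HasTemperateGrowth) (n : ℕ) :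
    ∃ (C : ℝ) (l : ℕ), 0 ≤ C ∧ ∀ x, ‖iteratedFDeriv ℝ n (fun x => Real.exp (-g x)) x‖ ≤
      C * (1 + ‖x‖) ^ l * Real.exp (-g x) := by
  obtain ⟨l, C, hC, hl⟩ := hg.norm_iteratedFDeriv_le_uniform n
  refine ⟨n ! * (C + 1) ^ n, l * n, by positivity, fun x => ?_⟩
  have hexp (i : ℕ) (y : ℝ) : ‖iteratedFDeriv ℝ i Real.exp y‖ ≤ Real.exp y := by
    rw [norm_iteratedFDeriv_eq_norm_iteratedDeriv, iteratedDeriv_eq_iterate, Real.iter_deriv_exp,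
      Real.norm_eq_abs, abs_of_pos (Real.exp_pos _)]
  have hcomp : ‖iteratedFDeriv ℝ n (Real.exp ∘ fun x => -g x) x‖ ≤
      n ! * Real.exp (-g x) * ((C + 1) * (1 + ‖x‖) ^ l) ^ n := by
    refine norm_iteratedFDeriv_comp_le (N := ∞) Real.contDiff_exp hg.1.neg (mod_cast le_top) x
      (fun i _ => hexp i _) fun i hi₁ hi => ?_
    have hone : 1 ≤ (C + 1) * (1 + ‖x‖) ^ l :=
      one_le_mul_of_one_le_of_one_le (by linarith) (one_le_pow₀ (by linarith [norm_nonneg x]))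
    refine le_trans ?_ (le_self_pow₀ hone (by omega))
    rw [show (fun x => -g x) = -g from rfl, iteratedFDeriv_neg_apply, norm_neg]
    exact (hl i hi x).trans (by gcongr; linarith)
  refine hcomp.trans_eq ?_
  rw [mul_pow, ← pow_mul]
  ring

/-- The Schwartz function `exp (-g)` for a function `g` of temperate growth that is bounded below
by a positive multiple of the square of the norm. -/
noncomputable def expNegS [NormedSpace ℝ E] (g : E → ℝ) (hg : g.HasTemperateGrowth) {c : ℝ}
    (hc : 0 < c) (hcg : ∀ x, c * ‖x‖ ^ 2 ≤ g x) : 𝓢(E, ℂ) where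
  toFun x := ((Real.exp (-g x) : ℝ) : ℂ)
  smooth' := Complex.ofRealCLM.contDiff.comp (Real.contDiff_exp.comp hg.1.neg)
  decay' k n := by
    obtain ⟨C, l, hC, hl⟩ := exists_norm_iteratedFDeriv_exp_neg_le hg n
    obtain ⟨K, hK⟩ := exists_one_add_pow_mul_exp_neg_le hc (k + l)
    refine ⟨C * K, fun x => ?_⟩
    have hreal : ‖iteratedFDeriv ℝ n (fun x => ((Real.exp (-g x) : ℝ) : ℂ)) x‖ =
        ‖iteratedFDeriv ℝ n (fun x => Real.exp (-g x)) x‖ :=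
      Complex.ofRealLI.norm_iteratedFDeriv_comp_left
        (Real.contDiff_exp.comp hg.1.neg).contDiffAt (mod_cast le_top)
    calc ‖x‖ ^ k * ‖iteratedFDeriv ℝ n (fun x => ((Real.exp (-g x) : ℝ) : ℂ)) x‖
        ≤ (1 + ‖x‖) ^ k * (C * (1 + ‖x‖) ^ l * Real.exp (-(c * ‖x‖ ^ 2))) := by
          rw [hreal]
          gcongr
          · linarith
          · refine (hl x).trans ?_
            gcongr
            exact hcg x
      _ = C * ((1 + ‖x‖) ^ (k + l) * Real.exp (-(c * ‖x‖ ^ 2))) := by rw [pow_add]; ring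
      _ ≤ C * K := by
          gcongr
          exact hK _ (norm_nonneg x)

theorem expNegS_apply [NormedSpace ℝ E] (g : E → ℝ) (hg : g.HasTemperateGrowth) {c : ℝ}
    (hc : 0 < c) (hcg : ∀ x, c * ‖x‖ ^ 2 ≤ g x) (x : E) :
    expNegS g hg hc hcg x = ((Real.exp (-g x) : ℝ) : ℂ) := rfl

variable [InnerProductSpace ℝ E] [MeasurableSpace E] [BorelSpace E] [FiniteDimensional ℝ E]

theorem ae_eq_zero_of_fourier_eq_zero {f : E → ℂ} (hf : Integrable f)
    (h : ∀ w : E, FourierTransform.fourier f w = 0) : f =ᵐ[volume] 0 := by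
  refine ae_eq_zero_of_integral_contDiff_smul_eq_zero hf.locallyIntegrable fun g hg hgc => ?_
  have hg' : ContDiff ℝ ∞ fun x => (g x : ℂ) := Complex.ofRealCLM.contDiff.comp hg
  have hgc' : HasCompactSupport fun x => (g x : ℂ) :=
    hgc.comp_left (g := Complex.ofReal) Complex.ofReal_zero
  let χ : 𝓢(E, ℂ) := FourierTransformInv.fourierInv (hgc'.toSchwartzMap hg')
  have hχ : ∀ x, VectorFourier.fourierIntegral Real.fourierChar volume (innerₗ E) χ x = g x :=
    fun x => by
      change FourierTransform.fourier (χ : E → ℂ) x = g x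
      rw [← SchwartzMap.fourier_coe]
      simp [χ]
  have hf₀ : ∀ x,
      VectorFourier.fourierIntegral Real.fourierChar volume (innerₗ E).flip f x = 0 := by
    rw [flip_innerₗ]
    exact h
  have hself := VectorFourier.integral_fourierIntegral_smul_eq_flip (μ := volume) (ν := volume)
    (L := innerₗ E) (f := χ) (g := f) Real.continuous_fourierChar continuous_inner χ.integrable hf
  simp only [hχ, hf₀, smul_zero, integral_zero] at hself
  simpa using hself

theorem fourier_eq_zero_of_forall_integral_inner_pow_eq_zero {f : E → ℂ} {w : E}
    (hf : AEStronglyMeasurable f)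
    (hexp : Integrable fun q => Real.exp (2 * Real.pi * |inner ℝ q w|) * ‖f q‖)
    (hmom : ∀ m : ℕ, ∫ q, (((inner ℝ q w) ^ m : ℝ) : ℂ) * f q = 0) :
    FourierTransform.fourier f w = 0 := by
  rw [Real.fourier_eq']
  have hs := hasSum_integral_of_dominated_convergence (μ := volume)
    (F := fun (m : ℕ) q => ((-2 * Real.pi * Complex.I) ^ m / m !) *
      ((((inner ℝ q w) ^ m : ℝ) : ℂ) * f q))
    (f := fun q => Complex.exp (((-2 * Real.pi * inner ℝ q w : ℝ) : ℂ) * Complex.I) • f q)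
    (bound := fun m q => (2 * Real.pi * |inner ℝ q w|) ^ m / m ! * ‖f q‖)
    (fun m => ?_) (fun m => .of_forall fun q => ?_) (.of_forall fun q => ?_) ?_
    (.of_forall fun q => ?_)
  · simp only [integral_const_mul, hmom, mul_zero] at hs
    exact hs.unique hasSum_zero
  · exact ((Continuous.aestronglyMeasurable (by fun_prop)).mul hf).const_mul _
  · refine le_of_eq ?_
    simp only [norm_mul, norm_div, norm_pow, Complex.norm_real, Complex.norm_I,
      Complex.norm_natCast, Real.norm_eq_abs, abs_of_pos Real.pi_pos, norm_neg,
      Complex.norm_ofNat, mul_pow, one_pow]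
    ring
  · exact (Real.summable_pow_div_factorial _).mul_right _
  · refine hexp.congr (.of_forall fun q => ?_)
    simp only [tsum_mul_right]
    rw [Real.exp_eq_exp_ℝ, NormedSpace.exp_eq_tsum_div]
  · have hsum := NormedSpace.expSeries_div_hasSum_exp
      (((-2 * Real.pi * inner ℝ q w : ℝ) : ℂ) * Complex.I)
    rw [← Complex.exp_eq_exp_ℂ] at hsum
    refine (hsum.mul_right (f q)).congr_fun fun m => ?_
    push_cast
    ring

theorem integrable_exp_mul_norm_expNegS_mul {g : E → ℝ} (hg : g.HasTemperateGrowth)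
    {c : ℝ} (hc : 0 < c) (hcg : ∀ x, c * ‖x‖ ^ 2 ≤ g x) {F : E → ℂ} (hF : MemLp F 2) (a : ℝ) :
    Integrable fun q => Real.exp (a * ‖q‖) * ‖expNegS g hg hc hcg q * F q‖ := by
  have hg_half : (fun x => g x / 2).HasTemperateGrowth := by
    simp_rw [div_eq_mul_inv]
    exact hg.mul (.const _)
  let G := expNegS (fun x => g x / 2) hg_half (half_pos hc) fun x => by linarith [hcg x]
  have hGF : Integrable fun q => ‖G q * F q‖ := ((G.memLp 2).integrable_mul hF).norm
  refine (hGF.const_mul (Real.exp (a ^ 2 / (4 * (c / 2))))).mono ?_ (.of_forall fun q => ?_)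
  · exact (Continuous.aestronglyMeasurable (by fun_prop)).mul
      ((expNegS g hg hc hcg).continuous.aestronglyMeasurable.mul hF.1).norm
  rw [Real.norm_of_nonneg (by positivity), Real.norm_of_nonneg (by positivity), norm_mul, norm_mul,
    ← mul_assoc, ← mul_assoc]
  refine mul_le_mul_of_nonneg_right ?_ (norm_nonneg _)
  rw [expNegS_apply, expNegS_apply, Complex.norm_real, Complex.norm_real,
    Real.norm_of_nonneg (Real.exp_pos _).le, Real.norm_of_nonneg (Real.exp_pos _).le,
    ← Real.exp_add, ← Real.exp_add, Real.exp_le_exp]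
  linarith [mul_sub_mul_sq_le (half_pos hc) a ‖q‖, hcg q]

theorem ae_eq_zero_of_forall_integral_inner_pow_mul_expNegS_eq_zero {g : E → ℝ}
    (hg : g.HasTemperateGrowth) {c : ℝ} (hc : 0 < c) (hcg : ∀ x, c * ‖x‖ ^ 2 ≤ g x) {F : E → ℂ}
    (hF : MemLp F 2)
    (h : ∀ (w : E) (m : ℕ),
      ∫ q, (((inner ℝ q w) ^ m : ℝ) : ℂ) * (expNegS g hg hc hcg q * F q) = 0) :
    F =ᵐ[volume] 0 := by
  have hmeas : AEStronglyMeasurable fun q => expNegS g hg hc hcg q * F q :=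
    (expNegS g hg hc hcg).continuous.aestronglyMeasurable.mul hF.1
  have hinteg (w : E) : Integrable fun q =>
      Real.exp (2 * Real.pi * |inner ℝ q w|) * ‖expNegS g hg hc hcg q * F q‖ := by
    refine (integrable_exp_mul_norm_expNegS_mul hg hc hcg hF (2 * Real.pi * ‖w‖)).mono
      ((Continuous.aestronglyMeasurable (by fun_prop)).mul hmeas.norm) (.of_forall fun q => ?_)
    rw [Real.norm_of_nonneg (by positivity), Real.norm_of_nonneg (by positivity),
      mul_assoc _ ‖w‖, mul_comm ‖w‖]
    gcongr
    exact abs_real_inner_le_norm q w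
  have hzero := ae_eq_zero_of_fourier_eq_zero
    ((integrable_norm_iff hmeas).1 (by simpa using hinteg 0))
    fun w => fourier_eq_zero_of_forall_integral_inner_pow_eq_zero hmeas (hinteg w) (h w)
  filter_upwards [hzero] with q hq
  exact (mul_eq_zero.1 hq).resolve_left (Complex.ofReal_ne_zero.2 (Real.exp_pos _).ne')

end Gaussian

/-! ## The canonical commutation relations -/

attribute [local instance] LieRing.ofAssociativeRing

section CanonicalCommutationRelations

variable {ι : Type*} [Fintype ι]

theorem lie_posS_posS (x y : ι) : ⁅posS x, posS y⁆ = (0 : Module.End ℂ (Schw ι)) := by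
  ext f q
  rw [Ring.lie_def, LinearMap.sub_apply, Module.End.mul_apply, Module.End.mul_apply, sub_apply,
    posS_apply, posS_apply, posS_apply, posS_apply, mul_left_comm, sub_self]
  rfl

theorem momS_momS_apply [DecidableEq ι] (x y : ι) (f : Schw ι) (q : EuclideanSpace ℝ ι) :
    momS x (momS y f) q = -fderiv ℝ (fderiv ℝ f) q (EuclideanSpace.single x (1 : ℝ))
      (EuclideanSpace.single y (1 : ℝ)) := by
  have hf' : DifferentiableAt ℝ (fderiv ℝ f) q :=
    ((f.smooth 2).fderiv_right (m := 1) (by norm_num)).differentiable (by norm_num) q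
  have hfy : HasFDerivAt (fun q => fderiv ℝ f q (EuclideanSpace.single y (1 : ℝ)))
      ((fderiv ℝ (fderiv ℝ f) q).flip (EuclideanSpace.single y (1 : ℝ))) q := by
    simpa using hf'.hasFDerivAt.clm_apply (hasFDerivAt_const (EuclideanSpace.single y (1 : ℝ)) q)
  have hmom : (momS y f : EuclideanSpace ℝ ι → ℂ) =
      fun q => -Complex.I * fderiv ℝ f q (EuclideanSpace.single y (1 : ℝ)) :=
    funext (momS_apply y f)
  rw [momS_apply, hmom, (hfy.const_mul (-Complex.I)).fderiv, smul_apply,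
    ContinuousLinearMap.flip_apply, smul_eq_mul, ← mul_assoc, neg_mul_neg, Complex.I_mul_I,
    neg_one_mul]

theorem lie_momS_momS (x y : ι) : ⁅momS x, momS y⁆ = (0 : Module.End ℂ (Schw ι)) := by
  classical
  ext f q
  have hsymm : IsSymmSndFDerivAt ℝ f q := (f.smooth 2).contDiffAt.isSymmSndFDerivAt (by simp)
  rw [Ring.lie_def, LinearMap.sub_apply, Module.End.mul_apply, Module.End.mul_apply, sub_apply,
    momS_momS_apply, momS_momS_apply, hsymm.eq, sub_self]
  rfl

theorem lie_posS_momS [DecidableEq ι] (x y : ι) :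
    ⁅posS x, momS y⁆ = ((if x = y then Complex.I else 0) • 1 : Module.End ℂ (Schw ι)) := by
  ext f q
  have hpos : (posS x f : EuclideanSpace ℝ ι → ℂ) = fun q => ((q x : ℝ) : ℂ) * f q :=
    funext (posS_apply x f)
  have hx : HasFDerivAt (fun q : EuclideanSpace ℝ ι => ((q x : ℝ) : ℂ))
      (Complex.ofRealCLM.comp (EuclideanSpace.proj x : EuclideanSpace ℝ ι →L[ℝ] ℝ)) q :=
    (Complex.ofRealCLM.comp (EuclideanSpace.proj x : EuclideanSpace ℝ ι →L[ℝ] ℝ)).hasFDerivAt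
  have hderiv : fderiv ℝ (posS x f) q (EuclideanSpace.single y (1 : ℝ)) =
      (q x : ℂ) * fderiv ℝ f q (EuclideanSpace.single y (1 : ℝ)) +
        f q * if x = y then 1 else 0 := by
    rw [hpos, (hx.fun_mul (f.hasFDerivAt q)).fderiv]
    by_cases hxy : x = y <;> simp [hxy]
  rw [Ring.lie_def, LinearMap.sub_apply, Module.End.mul_apply, Module.End.mul_apply, sub_apply,
    posS_apply, momS_apply, momS_apply, hderiv, LinearMap.smul_apply, smul_apply,
    Module.End.one_apply, smul_eq_mul]
  split_ifs <;> ring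

end CanonicalCommutationRelations

theorem lie_sq_of_lie_eq_smul_one {R : Type*} [Ring R] [Algebra ℂ R] {A B : R} {c : ℂ}
    (h : ⁅A, B⁆ = c • 1) : ⁅A ^ 2, B⁆ = (2 * c) • A := by
  calc ⁅A ^ 2, B⁆ = A * ⁅A, B⁆ + ⁅A, B⁆ * A := by simp only [Ring.lie_def]; noncomm_ring
    _ = (2 * c) • A := by
      rw [h, mul_smul_comm, smul_mul_assoc, mul_one, one_mul, ← add_smul, two_mul]

/-! ## Normal modes and the Fock basis -/

/-- Normal modes of a system of coupled oscillators: the `j`-th mode has frequency `2 ω j`, position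
`Q_j = ∑_x O_{x,j} s_x⁻¹ q_x` and momentum `P_j = ∑_x O_{x,j} s_x p_x`, where `O` is orthogonal. -/
structure NormalModes (ι : Type*) [Fintype ι] [DecidableEq ι] where
  O : Matrix ι ι ℝ
  s : ι → ℝ
  ω : ι → ℝ
  s_pos : ∀ x, 0 < s x
  ω_pos : ∀ j, 0 < ω j
  orth : O.transpose * O = 1

namespace NormalModes

variable {ι : Type*} [Fintype ι] [DecidableEq ι] (M : NormalModes ι)

theorem sum_col (j k : ι) : ∑ x, M.O x j * M.O x k = if j = k then 1 else 0 := by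
  simpa [Matrix.mul_apply, Matrix.one_apply] using congrFun₂ M.orth j k

theorem sum_row (x y : ι) : ∑ j, M.O x j * M.O y j = if x = y then 1 else 0 := by
  have h : M.O * M.O.transpose = 1 := mul_eq_one_comm.1 M.orth
  simpa [Matrix.mul_apply, Matrix.one_apply] using congrFun₂ h x y

/-- The position operator `Q_j` of a mode. -/
noncomputable def modePos (j : ι) : Module.End ℂ (Schw ι) :=
  ∑ x, ((M.O x j / M.s x : ℝ) : ℂ) • posS x

/-- The momentum operator `P_j` of a mode. -/
noncomputable def modeMom (j : ι) : Module.End ℂ (Schw ι) :=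
  ∑ x, ((M.O x j * M.s x : ℝ) : ℂ) • momS x

/-- The Hamiltonian `∑_j (P_j² + ω_j² Q_j²)` on the Schwartz space. -/
noncomputable def hamS : Module.End ℂ (Schw ι) :=
  ∑ j, (M.modeMom j ^ 2 + ((M.ω j ^ 2 : ℝ) : ℂ) • M.modePos j ^ 2)

theorem formalAdj_modePos (j : ι) : FormalAdj (M.modePos j) (M.modePos j) :=
  FormalAdj.sum _ fun x _ => (formalAdj_posS x).ofReal_smul _

theorem formalAdj_modeMom (j : ι) : FormalAdj (M.modeMom j) (M.modeMom j) :=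
  FormalAdj.sum _ fun x _ => (formalAdj_momS x).ofReal_smul _

theorem formalAdj_hamS : FormalAdj M.hamS M.hamS := by
  refine FormalAdj.sum _ fun j _ => ?_
  rw [pow_two, pow_two]
  exact ((M.formalAdj_modeMom j).mul (M.formalAdj_modeMom j)).add
    (((M.formalAdj_modePos j).mul (M.formalAdj_modePos j)).ofReal_smul _)

theorem posS_eq_sum_modePos (x : ι) :
    posS x = (M.s x : ℂ) • ∑ j, (M.O x j : ℂ) • M.modePos j := by
  have hcoef (y : ι) : ∑ j, (M.s x : ℂ) * ((M.O x j : ℂ) * ((M.O y j / M.s y : ℝ) : ℂ)) =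
      if x = y then 1 else 0 := by
    rw [← Finset.mul_sum]
    have hsum : ∑ j, (M.O x j : ℂ) * ((M.O y j / M.s y : ℝ) : ℂ) =
        (((∑ j, M.O x j * M.O y j) / M.s y : ℝ) : ℂ) := by
      push_cast
      simp only [Finset.sum_div, mul_div_assoc]
    rw [hsum, sum_row]
    split_ifs with hxy
    · subst hxy
      rw [← Complex.ofReal_mul, mul_one_div_cancel (M.s_pos x).ne', Complex.ofReal_one]
    · simp
  simp only [modePos, Finset.smul_sum, smul_smul]
  rw [Finset.sum_comm]
  simp only [← Finset.sum_smul, hcoef, ite_smul, one_smul, zero_smul,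
    Finset.sum_ite_eq, Finset.mem_univ, if_true]

theorem momS_eq_sum_modeMom (x : ι) :
    momS x = ((M.s x)⁻¹ : ℂ) • ∑ j, (M.O x j : ℂ) • M.modeMom j := by
  have hcoef (y : ι) : ∑ j, ((M.s x)⁻¹ : ℂ) * ((M.O x j : ℂ) * ((M.O y j * M.s y : ℝ) : ℂ)) =
      if x = y then 1 else 0 := by
    rw [← Finset.mul_sum]
    have hsum : ∑ j, (M.O x j : ℂ) * ((M.O y j * M.s y : ℝ) : ℂ) =
        (((∑ j, M.O x j * M.O y j) * M.s y : ℝ) : ℂ) := by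
      push_cast
      simp only [Finset.sum_mul, mul_assoc]
    rw [hsum, sum_row]
    split_ifs with hxy
    · subst hxy
      rw [one_mul, inv_mul_cancel₀ (Complex.ofReal_ne_zero.2 (M.s_pos x).ne')]
    · simp
  simp only [modeMom, Finset.smul_sum, smul_smul]
  rw [Finset.sum_comm]
  simp only [← Finset.sum_smul, hcoef, ite_smul, one_smul, zero_smul,
    Finset.sum_ite_eq, Finset.mem_univ, if_true]

theorem lie_modePos_posS (j y : ι) : ⁅M.modePos j, posS y⁆ = 0 := by
  simp only [modePos, sum_lie, smul_lie, lie_posS_posS, smul_zero, Finset.sum_const_zero]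

theorem lie_modeMom_momS (j y : ι) : ⁅M.modeMom j, momS y⁆ = 0 := by
  simp only [modeMom, sum_lie, smul_lie, lie_momS_momS, smul_zero, Finset.sum_const_zero]

theorem lie_modePos_momS (j y : ι) :
    ⁅M.modePos j, momS y⁆ = (Complex.I * (M.O y j / M.s y : ℝ)) • 1 := by
  simp only [modePos, sum_lie, smul_lie, lie_posS_momS, smul_smul, ite_smul, zero_smul, smul_ite,
    smul_zero, Finset.sum_ite_eq', Finset.mem_univ, if_true]
  rw [mul_comm]

theorem lie_modeMom_posS (j y : ι) :
    ⁅M.modeMom j, posS y⁆ = (-Complex.I * (M.O y j * M.s y : ℝ)) • 1 := by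
  simp only [modeMom, sum_lie, smul_lie, ← lie_skew (momS _) (posS y), lie_posS_momS, smul_neg,
    smul_smul, ite_smul, zero_smul, smul_ite, smul_zero, Finset.sum_neg_distrib,
    Finset.sum_ite_eq, Finset.mem_univ, if_true]
  rw [neg_mul, neg_smul, mul_comm]

theorem lie_modePos_modePos (j k : ι) : ⁅M.modePos j, M.modePos k⁆ = 0 := by
  rw [modePos.eq_def M k]
  simp only [lie_sum, lie_smul, lie_modePos_posS, smul_zero, Finset.sum_const_zero]

theorem lie_modeMom_modeMom (j k : ι) : ⁅M.modeMom j, M.modeMom k⁆ = 0 := by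
  rw [modeMom.eq_def M k]
  simp only [lie_sum, lie_smul, lie_modeMom_momS, smul_zero, Finset.sum_const_zero]

theorem lie_modePos_modeMom (j k : ι) :
    ⁅M.modePos j, M.modeMom k⁆ = (if j = k then Complex.I else 0) • 1 := by
  have hterm (x : ι) : ((M.O x k * M.s x : ℝ) : ℂ) * (Complex.I * (M.O x j / M.s x : ℝ)) =
      Complex.I * (M.O x j * M.O x k : ℝ) := by
    have := Complex.ofReal_ne_zero.2 (M.s_pos x).ne'
    push_cast
    field_simp
  conv_lhs => rw [modeMom]
  simp only [lie_sum, lie_smul, lie_modePos_momS, smul_smul, hterm, ← Finset.sum_smul,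
    ← Finset.mul_sum, ← Complex.ofReal_sum, sum_col]
  split_ifs <;> simp

theorem lie_hamS_modePos (j : ι) : ⁅M.hamS, M.modePos j⁆ = (-2 * Complex.I) • M.modeMom j := by
  have hMom (k : ι) : ⁅M.modeMom k ^ 2, M.modePos j⁆ =
      (2 * (if k = j then -Complex.I else 0)) • M.modeMom k :=
    lie_sq_of_lie_eq_smul_one <| by
      rw [← lie_skew, lie_modePos_modeMom]
      by_cases h : k = j <;> simp [h, eq_comm (a := j)]
  have hPos (k : ι) : ⁅M.modePos k ^ 2, M.modePos j⁆ = 0 := by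
    rw [lie_sq_of_lie_eq_smul_one (c := 0) (by rw [lie_modePos_modePos, zero_smul]), mul_zero,
      zero_smul]
  simp only [hamS, sum_lie, add_lie, smul_lie, hMom, hPos, smul_zero, add_zero, mul_ite, mul_zero,
    ite_smul, zero_smul, Finset.sum_ite_eq', Finset.mem_univ, if_true]
  rw [mul_neg, neg_mul]

theorem lie_hamS_modeMom (j : ι) :
    ⁅M.hamS, M.modeMom j⁆ = (2 * Complex.I * (M.ω j ^ 2 : ℝ)) • M.modePos j := by
  have hPos (k : ι) : ⁅M.modePos k ^ 2, M.modeMom j⁆ =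
      (2 * (if k = j then Complex.I else 0)) • M.modePos k :=
    lie_sq_of_lie_eq_smul_one (M.lie_modePos_modeMom k j)
  have hMom (k : ι) : ⁅M.modeMom k ^ 2, M.modeMom j⁆ = 0 := by
    rw [lie_sq_of_lie_eq_smul_one (c := 0) (by rw [lie_modeMom_modeMom, zero_smul]), mul_zero,
      zero_smul]
  simp only [hamS, sum_lie, add_lie, smul_lie, hMom, hPos, zero_add, mul_ite, mul_zero,
    ite_smul, zero_smul, smul_ite, smul_zero, smul_smul, Finset.sum_ite_eq', Finset.mem_univ,
    if_true]
  rw [mul_comm]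

/-! ### Creation and annihilation operators -/

/-- The annihilation operator `a_j = ω_j Q_j + i P_j`, normalized so that `[a_j, a_j†] = 2 ω_j`. -/
noncomputable def ann (j : ι) : Module.End ℂ (Schw ι) :=
  (M.ω j : ℂ) • M.modePos j + Complex.I • M.modeMom j

/-- The creation operator `a_j† = ω_j Q_j - i P_j`. -/
noncomputable def cre (j : ι) : Module.End ℂ (Schw ι) :=
  (M.ω j : ℂ) • M.modePos j - Complex.I • M.modeMom j

theorem modePos_eq (j : ι) : M.modePos j = (2 * M.ω j : ℂ)⁻¹ • (M.ann j + M.cre j) := by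
  have := Complex.ofReal_ne_zero.2 (M.ω_pos j).ne'
  rw [ann, cre]
  match_scalars
  · field_simp
    norm_num
  · ring

theorem modeMom_eq (j : ι) : M.modeMom j = (-(Complex.I / 2)) • (M.ann j - M.cre j) := by
  rw [ann, cre]
  match_scalars
  · linear_combination Complex.I_mul_I
  · ring

theorem formalAdj_cre_ann (j : ι) : FormalAdj (M.cre j) (M.ann j) := by
  have h := ((M.formalAdj_modePos j).ofReal_smul (M.ω j)).add
    ((M.formalAdj_modeMom j).smul (-Complex.I))
  rwa [map_neg, Complex.conj_I, neg_neg, neg_smul, ← sub_eq_add_neg] at h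

theorem cre_mul_ann (j : ι) : M.cre j * M.ann j + (M.ω j : ℂ) • 1 =
    M.modeMom j ^ 2 + ((M.ω j ^ 2 : ℝ) : ℂ) • M.modePos j ^ 2 := by
  have hccr : M.modePos j * M.modeMom j = M.modeMom j * M.modePos j + Complex.I • 1 := by
    have h := M.lie_modePos_modeMom j j
    rw [Ring.lie_def, if_pos rfl] at h
    exact sub_eq_iff_eq_add'.1 h
  simp only [ann, cre, sub_mul, mul_add, smul_mul_smul_comm, hccr, pow_two,
    Complex.ofReal_mul]
  linear_combination (norm := module)
    (M.ω j * Complex.I_sq) • (1 : Module.End ℂ (Schw ι)) -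
      Complex.I_sq • (M.modeMom j * M.modeMom j)

theorem hamS_eq_sum_cre_mul_ann : M.hamS = ∑ j, (M.cre j * M.ann j + (M.ω j : ℂ) • 1) :=
  Finset.sum_congr rfl fun j _ => (M.cre_mul_ann j).symm

theorem lie_hamS_cre (j : ι) : ⁅M.hamS, M.cre j⁆ = (2 * M.ω j : ℂ) • M.cre j := by
  rw [cre, lie_sub, lie_smul, lie_smul, lie_hamS_modePos, lie_hamS_modeMom]
  push_cast
  linear_combination (norm := module) (-2 * (M.ω j : ℂ) ^ 2 * Complex.I_sq) • M.modePos j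

theorem lie_hamS_ann (j : ι) : ⁅M.hamS, M.ann j⁆ = (-(2 * M.ω j) : ℂ) • M.ann j := by
  rw [ann, lie_add, lie_smul, lie_smul, lie_hamS_modePos, lie_hamS_modeMom]
  push_cast
  linear_combination (norm := module) (2 * (M.ω j : ℂ) ^ 2 * Complex.I_sq) • M.modePos j

theorem lie_ann_cre (j k : ι) :
    ⁅M.ann j, M.cre k⁆ = (if j = k then 2 * (M.ω j : ℂ) else 0) • 1 := by
  simp only [ann, cre, add_lie, lie_sub, smul_lie, lie_smul, lie_modePos_modePos,
    lie_modeMom_modeMom, lie_modePos_modeMom, ← lie_skew (M.modeMom j) (M.modePos k)]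
  by_cases h : j = k
  · subst h
    simp only [if_true]
    match_scalars
    linear_combination (-2 * (M.ω j : ℂ)) * Complex.I_sq
  · simp [h, Ne.symm h]

theorem lie_cre_cre (j k : ι) : ⁅M.cre j, M.cre k⁆ = 0 := by
  simp only [cre, sub_lie, lie_sub, smul_lie, lie_smul, lie_modePos_modePos,
    lie_modeMom_modeMom, lie_modePos_modeMom, ← lie_skew (M.modeMom j) (M.modePos k)]
  by_cases h : j = k
  · subst h
    simp only [if_true]
    module
  · simp [h, Ne.symm h]

theorem ann_cre_apply (j k : ι) (f : Schw ι) : M.ann j (M.cre k f) =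
    M.cre k (M.ann j f) + (if j = k then 2 * (M.ω j : ℂ) else 0) • f :=
  sub_eq_iff_eq_add'.1 (LinearMap.congr_fun (M.lie_ann_cre j k) f)

theorem cre_cre_comm (j k : ι) (f : Schw ι) : M.cre j (M.cre k f) = M.cre k (M.cre j f) :=
  sub_eq_zero.1 (LinearMap.congr_fun (M.lie_cre_cre j k) f)

end NormalModes

namespace NormalModes

variable {ι : Type*} [Fintype ι] [DecidableEq ι] (M : NormalModes ι)

/-! ### The ground state -/

/-- The coordinate of which the mode position operator `Q_j` is the multiplication operator. -/
noncomputable def coord (j : ι) : EuclideanSpace ℝ ι →L[ℝ] ℝ :=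
  ∑ x, (M.O x j / M.s x) • (EuclideanSpace.proj x : EuclideanSpace ℝ ι →L[ℝ] ℝ)

theorem coord_apply (j : ι) (q : EuclideanSpace ℝ ι) :
    M.coord j q = ∑ x, M.O x j / M.s x * q x := by
  simp [coord]

theorem sum_mul_coord (x : ι) (q : EuclideanSpace ℝ ι) :
    ∑ j, M.O x j * M.coord j q = q x / M.s x := by
  simp only [coord_apply, Finset.mul_sum]
  rw [Finset.sum_comm]
  calc ∑ y, ∑ j, M.O x j * (M.O y j / M.s y * q y)
      = ∑ y, (∑ j, M.O x j * M.O y j) * (q y / M.s y) := by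
        simp only [Finset.sum_mul]
        exact Finset.sum_congr rfl fun y _ => Finset.sum_congr rfl fun j _ => by ring
    _ = q x / M.s x := by
        simp only [sum_row, ite_mul, one_mul, zero_mul, Finset.sum_ite_eq, Finset.mem_univ, if_true]

/-- The direction in which the mode momentum operator `P_j` differentiates. -/
noncomputable def modeVec (j : ι) : EuclideanSpace ℝ ι :=
  ∑ x, (M.O x j * M.s x) • EuclideanSpace.single x 1

theorem coord_modeVec (k j : ι) : M.coord k (M.modeVec j) = if k = j then 1 else 0 := by
  rw [modeVec, map_sum, ← M.sum_col k j]
  refine Finset.sum_congr rfl fun x _ => ?_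
  have hs := (M.s_pos x).ne'
  simp only [map_smul, coord_apply, PiLp.single_apply, mul_ite, mul_one, mul_zero,
    Finset.sum_ite_eq', Finset.mem_univ, if_true, smul_eq_mul]
  field_simp

theorem modePos_apply (j : ι) (f : Schw ι) (q : EuclideanSpace ℝ ι) :
    M.modePos j f q = (M.coord j q : ℂ) * f q := by
  simp only [modePos, LinearMap.sum_apply, LinearMap.smul_apply, sum_apply, smul_apply, posS_apply,
    smul_eq_mul, coord_apply]
  push_cast
  simp only [Finset.sum_mul, mul_assoc]

theorem modeMom_apply (j : ι) (f : Schw ι) (q : EuclideanSpace ℝ ι) :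
    M.modeMom j f q = -Complex.I * fderiv ℝ f q (M.modeVec j) := by
  simp only [modeMom, modeVec, LinearMap.sum_apply, LinearMap.smul_apply, sum_apply, smul_apply,
    momS_apply, smul_eq_mul, map_sum, map_smul, Complex.real_smul, Finset.mul_sum]
  exact Finset.sum_congr rfl fun x _ => mul_left_comm _ _ _

/-- The exponent `½ ∑_j ω_j Q_j²` of the ground state. -/
noncomputable def vacExp (q : EuclideanSpace ℝ ι) : ℝ := ∑ j, M.ω j / 2 * M.coord j q ^ 2

theorem vacExp_hasTemperateGrowth : M.vacExp.HasTemperateGrowth :=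
  Function.HasTemperateGrowth.sum fun j _ =>
    (Function.HasTemperateGrowth.const (M.ω j / 2)).mul ((M.coord j).hasTemperateGrowth.pow 2)

theorem vacExp_nonneg (q : EuclideanSpace ℝ ι) : 0 ≤ M.vacExp q :=
  Finset.sum_nonneg fun j _ => mul_nonneg (half_pos (M.ω_pos j)).le (sq_nonneg _)

theorem sq_coord_le (j : ι) (q : EuclideanSpace ℝ ι) :
    M.coord j q ^ 2 ≤ 2 / M.ω j * M.vacExp q := by
  have hterm : M.ω j / 2 * M.coord j q ^ 2 ≤ M.vacExp q :=
    Finset.single_le_sum (f := fun j => M.ω j / 2 * M.coord j q ^ 2)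
      (fun j _ => mul_nonneg (half_pos (M.ω_pos j)).le (sq_nonneg _)) (Finset.mem_univ j)
  have hω := M.ω_pos j
  calc M.coord j q ^ 2 = 2 / M.ω j * (M.ω j / 2 * M.coord j q ^ 2) := by field_simp
    _ ≤ 2 / M.ω j * M.vacExp q := by gcongr

theorem sq_apply_le (x : ι) (q : EuclideanSpace ℝ ι) :
    q x ^ 2 ≤ M.s x ^ 2 * (∑ j, 2 / M.ω j) * M.vacExp q := by
  have hrow : ∑ j, M.O x j ^ 2 = 1 := by simpa [pow_two] using M.sum_row x x
  calc q x ^ 2 = M.s x ^ 2 * (∑ j, M.O x j * M.coord j q) ^ 2 := by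
        rw [sum_mul_coord, ← mul_pow, mul_div_cancel₀ _ (M.s_pos x).ne']
    _ ≤ M.s x ^ 2 * ((∑ j, M.O x j ^ 2) * ∑ j, M.coord j q ^ 2) := by
        gcongr
        exact Finset.sum_mul_sq_le_sq_mul_sq _ _ _
    _ ≤ M.s x ^ 2 * ∑ j, 2 / M.ω j * M.vacExp q := by
        rw [hrow, one_mul]
        gcongr with j
        exact M.sq_coord_le j q
    _ = M.s x ^ 2 * (∑ j, 2 / M.ω j) * M.vacExp q := by rw [← Finset.sum_mul, mul_assoc]

theorem exists_mul_sq_norm_le_vacExp : ∃ c : ℝ, 0 < c ∧ ∀ q, c * ‖q‖ ^ 2 ≤ M.vacExp q := by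
  have hK : 0 < 1 + ∑ x, M.s x ^ 2 * ∑ j, 2 / M.ω j :=
    add_pos_of_pos_of_nonneg one_pos <| Finset.sum_nonneg fun x _ => mul_nonneg (sq_nonneg _)
      (Finset.sum_nonneg fun j _ => div_nonneg zero_le_two (M.ω_pos j).le)
  refine ⟨(1 + ∑ x, M.s x ^ 2 * ∑ j, 2 / M.ω j)⁻¹, inv_pos.2 hK, fun q => ?_⟩
  rw [inv_mul_le_iff₀ hK, EuclideanSpace.real_norm_sq_eq, add_mul, one_mul, Finset.sum_mul]
  exact (Finset.sum_le_sum fun x _ => M.sq_apply_le x q).trans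
    (le_add_of_nonneg_left (M.vacExp_nonneg q))

/-- The ground state `exp (-½ ∑_j ω_j Q_j²)`. -/
noncomputable def vac : Schw ι :=
  expNegS M.vacExp M.vacExp_hasTemperateGrowth M.exists_mul_sq_norm_le_vacExp.choose_spec.1
    M.exists_mul_sq_norm_le_vacExp.choose_spec.2

theorem vac_apply (q : EuclideanSpace ℝ ι) : M.vac q = ((Real.exp (-M.vacExp q) : ℝ) : ℂ) := rfl

theorem fderiv_vac (q v : EuclideanSpace ℝ ι) :
    fderiv ℝ M.vac q v = -((∑ j, M.ω j * M.coord j q * M.coord j v : ℝ) : ℂ) * M.vac q := by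
  have hexp : HasFDerivAt M.vacExp (∑ j, (M.ω j / 2) • ((2 * M.coord j q) • M.coord j)) q := by
    refine HasFDerivAt.fun_sum fun j _ => HasFDerivAt.const_mul ?_ _
    simpa using (M.coord j).hasFDerivAt.pow 2
  have hvac : HasFDerivAt M.vac (Complex.ofRealCLM.comp (Real.exp (-M.vacExp q) •
      -∑ j, (M.ω j / 2) • ((2 * M.coord j q) • M.coord j))) q :=
    Complex.ofRealCLM.hasFDerivAt.comp q hexp.neg.exp
  rw [hvac.fderiv, vac_apply]
  simp only [ContinuousLinearMap.comp_apply, smul_apply, neg_apply, sum_apply,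
    Complex.ofRealCLM_apply, smul_eq_mul]
  rw [← Complex.ofReal_neg, ← Complex.ofReal_mul, mul_comm]
  congr 3
  exact Finset.sum_congr rfl fun j _ => by ring

theorem ann_vac (j : ι) : M.ann j M.vac = 0 := by
  ext q
  have hMom : M.modeMom j M.vac q = Complex.I * (M.ω j * M.coord j q) * M.vac q := by
    rw [modeMom_apply, fderiv_vac]
    simp only [coord_modeVec, mul_ite, mul_one, mul_zero, Finset.sum_ite_eq', Finset.mem_univ,
      if_true]
    push_cast
    ring
  change (M.ω j : ℂ) * M.modePos j M.vac q + Complex.I * M.modeMom j M.vac q = 0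
  rw [hMom, modePos_apply]
  linear_combination (M.ω j * M.coord j q * M.vac q) * Complex.I_sq

/-! ### The Fock basis -/

instance : LeftCommutative fun (j : ι) (f : Schw ι) => M.cre j f :=
  ⟨fun j k f => M.cre_cre_comm j k f⟩

/-- The unnormalized Fock vector `∏_{j ∈ n} a_j† Ω`, where `Ω` is the ground state. -/
noncomputable def fock (n : Multiset ι) : Schw ι := n.foldr (fun j f => M.cre j f) M.vac

theorem fock_zero : M.fock 0 = M.vac := rfl

theorem fock_cons (j : ι) (n : Multiset ι) : M.fock (j ::ₘ n) = M.cre j (M.fock n) :=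
  Multiset.foldr_cons _ _ _ _

theorem cre_ann_fock (j : ι) (n : Multiset ι) :
    M.cre j (M.ann j (M.fock n)) = (2 * M.ω j * n.count j : ℂ) • M.fock n := by
  induction n using Multiset.induction_on with
  | empty => simp [fock_zero, ann_vac]
  | cons k n ih =>
    rw [fock_cons, ann_cre_apply, map_add, cre_cre_comm, ih, map_smul, map_smul]
    by_cases h : j = k
    · subst h
      rw [if_pos rfl, ← add_smul, Multiset.count_cons_self]
      congr 1
      push_cast
      ring
    · rw [if_neg h, zero_smul, add_zero, Multiset.count_cons_of_ne h]

/-- The energy of a Fock vector. -/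
noncomputable def energy (n : Multiset ι) : ℝ := ∑ j, (2 * M.ω j * n.count j + M.ω j)

theorem hamS_fock (n : Multiset ι) : M.hamS (M.fock n) = (M.energy n : ℂ) • M.fock n := by
  rw [hamS_eq_sum_cre_mul_ann, energy, LinearMap.sum_apply, Complex.ofReal_sum, Finset.sum_smul]
  refine Finset.sum_congr rfl fun j _ => ?_
  rw [LinearMap.add_apply, Module.End.mul_apply, cre_ann_fock, LinearMap.smul_apply,
    Module.End.one_apply, ← add_smul]
  push_cast
  rfl

theorem norm_sq_cre (j : ι) (f : Schw ι) : ‖schwToL2 ι (M.cre j f)‖ ^ 2 =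
    ‖schwToL2 ι (M.ann j f)‖ ^ 2 + 2 * M.ω j * ‖schwToL2 ι f‖ ^ 2 := by
  have h := M.formalAdj_cre_ann j f (M.cre j f)
  rw [ann_cre_apply, if_pos rfl, map_add, inner_add_right, ← (M.formalAdj_cre_ann j).symm f,
    map_smul, inner_smul_right, inner_self_eq_norm_sq_to_K, inner_self_eq_norm_sq_to_K,
    inner_self_eq_norm_sq_to_K] at h
  simp only [Complex.coe_algebraMap] at h
  exact_mod_cast h

theorem vac_ne_zero : M.vac ≠ 0 := fun h => by
  have h₀ : M.vac 0 = 0 := by rw [h]; rfl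
  rw [vac_apply] at h₀
  exact (Real.exp_pos _).ne' (Complex.ofReal_eq_zero.1 h₀)

theorem schwToL2_fock_ne_zero (n : Multiset ι) : schwToL2 ι (M.fock n) ≠ 0 := by
  induction n using Multiset.induction_on with
  | empty => exact (map_ne_zero_iff _ (schwToL2_injective ι)).2 M.vac_ne_zero
  | cons k n ih =>
    have hpos : 0 < ‖schwToL2 ι (M.fock (k ::ₘ n))‖ ^ 2 := by
      rw [fock_cons, norm_sq_cre]
      exact add_pos_of_nonneg_of_pos (sq_nonneg _)
        (mul_pos (mul_pos two_pos (M.ω_pos k)) (pow_pos (norm_pos_iff.2 ih) 2))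
    exact fun h => by simp [h] at hpos

theorem inner_fock_of_ne {n m : Multiset ι} (h : n ≠ m) :
    inner ℂ (schwToL2 ι (M.fock n)) (schwToL2 ι (M.fock m)) = 0 := by
  obtain ⟨j, hj⟩ : ∃ j, n.count j ≠ m.count j := by
    by_contra! hc
    exact h (Multiset.ext.2 hc)
  have hnum := ((M.formalAdj_cre_ann j).mul (M.formalAdj_cre_ann j).symm) (M.fock n) (M.fock m)
  rw [Module.End.mul_apply, Module.End.mul_apply, cre_ann_fock, cre_ann_fock, map_smul, map_smul,
    inner_smul_left, inner_smul_right] at hnum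
  simp only [map_mul, Complex.conj_ofReal, map_ofNat, map_natCast] at hnum
  have hω : (M.ω j : ℂ) ≠ 0 := Complex.ofReal_ne_zero.2 (M.ω_pos j).ne'
  have hcount : (n.count j : ℂ) - m.count j ≠ 0 := sub_ne_zero.2 (mod_cast hj)
  refine (mul_eq_zero.1 ?_).resolve_left (mul_ne_zero (mul_ne_zero two_ne_zero hω) hcount)
  linear_combination hnum

/-- The normalized Fock vectors. -/
noncomputable def fockUnit (n : Multiset ι) : Schw ι :=
  ((‖schwToL2 ι (M.fock n)‖⁻¹ : ℝ) : ℂ) • M.fock n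

theorem norm_smul_fockUnit (n : Multiset ι) :
    (‖schwToL2 ι (M.fock n)‖ : ℂ) • M.fockUnit n = M.fock n := by
  rw [fockUnit, smul_smul, ← Complex.ofReal_mul,
    mul_inv_cancel₀ (norm_ne_zero_iff.2 (M.schwToL2_fock_ne_zero n)), Complex.ofReal_one, one_smul]

theorem orthonormal_fockUnit : Orthonormal ℂ fun n => schwToL2 ι (M.fockUnit n) := by
  refine ⟨fun n => ?_, fun n m h => ?_⟩
  · change ‖schwToL2 ι (M.fockUnit n)‖ = 1
    rw [fockUnit, map_smul, norm_smul, Complex.norm_real, norm_inv, norm_norm,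
      inv_mul_cancel₀ (norm_ne_zero_iff.2 (M.schwToL2_fock_ne_zero n))]
  · simp only [fockUnit, map_smul, inner_smul_left, inner_smul_right, M.inner_fock_of_ne h,
      mul_zero]

/-- The space of finite linear combinations of Fock vectors. -/
noncomputable def fockSpan : Submodule ℂ (Schw ι) := Submodule.span ℂ (Set.range M.fock)

theorem fock_mem_fockSpan (n : Multiset ι) : M.fock n ∈ M.fockSpan :=
  Submodule.subset_span ⟨n, rfl⟩

theorem map_mem_fockSpan {A : Module.End ℂ (Schw ι)} (h : ∀ n, A (M.fock n) ∈ M.fockSpan)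
    {f : Schw ι} (hf : f ∈ M.fockSpan) : A f ∈ M.fockSpan :=
  have hle : M.fockSpan ≤ M.fockSpan.comap A := Submodule.span_le.2 (Set.range_subset_iff.2 h)
  hle hf

theorem cre_mem_fockSpan (j : ι) {f : Schw ι} (hf : f ∈ M.fockSpan) : M.cre j f ∈ M.fockSpan :=
  M.map_mem_fockSpan (fun n => M.fock_cons j n ▸ M.fock_mem_fockSpan _) hf

theorem ann_mem_fockSpan (j : ι) {f : Schw ι} (hf : f ∈ M.fockSpan) : M.ann j f ∈ M.fockSpan := by
  refine M.map_mem_fockSpan (fun n => ?_) hf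
  induction n using Multiset.induction_on with
  | empty => rw [fock_zero, ann_vac]; exact zero_mem _
  | cons k n ih =>
    rw [fock_cons, ann_cre_apply]
    exact add_mem (M.cre_mem_fockSpan k ih) (Submodule.smul_mem _ _ (M.fock_mem_fockSpan n))

theorem posS_mem_fockSpan (x : ι) {f : Schw ι} (hf : f ∈ M.fockSpan) : posS x f ∈ M.fockSpan := by
  rw [M.posS_eq_sum_modePos, LinearMap.smul_apply, LinearMap.sum_apply]
  refine Submodule.smul_mem _ _ (sum_mem fun j _ => Submodule.smul_mem _ _ ?_)
  rw [modePos_eq]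
  exact Submodule.smul_mem _ _ (add_mem (M.ann_mem_fockSpan j hf) (M.cre_mem_fockSpan j hf))

theorem momS_mem_fockSpan (x : ι) {f : Schw ι} (hf : f ∈ M.fockSpan) : momS x f ∈ M.fockSpan := by
  rw [M.momS_eq_sum_modeMom, LinearMap.smul_apply, LinearMap.sum_apply]
  refine Submodule.smul_mem _ _ (sum_mem fun j _ => Submodule.smul_mem _ _ ?_)
  rw [modeMom_eq]
  exact Submodule.smul_mem _ _ (sub_mem (M.ann_mem_fockSpan j hf) (M.cre_mem_fockSpan j hf))

theorem exists_mem_fockSpan_inner_pow_mul_vac (w : EuclideanSpace ℝ ι) (m : ℕ) :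
    ∃ f ∈ M.fockSpan, ∀ q, f q = (((inner ℝ q w) ^ m : ℝ) : ℂ) * M.vac q := by
  induction m with
  | zero => exact ⟨M.vac, M.fock_mem_fockSpan 0, fun q => by simp⟩
  | succ m ih =>
    obtain ⟨f, hf, hfq⟩ := ih
    refine ⟨∑ x, (w x : ℂ) • posS x f,
      sum_mem fun x _ => Submodule.smul_mem _ _ (M.posS_mem_fockSpan x hf), fun q => ?_⟩
    have hinner : ((inner ℝ q w : ℝ) : ℂ) = ∑ x, (w x : ℂ) * q x := by
      rw [PiLp.inner_apply, Complex.ofReal_sum]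
      exact Finset.sum_congr rfl fun x _ => Complex.ofReal_mul _ _
    simp only [sum_apply, smul_apply, smul_eq_mul, posS_apply, hfq, ← mul_assoc, ← Finset.sum_mul]
    rw [← hinner]
    push_cast
    ring

theorem eq_zero_of_forall_inner_fockSpan {ψ : L2 ι}
    (h : ∀ f ∈ M.fockSpan, inner ℂ (schwToL2 ι f) ψ = 0) : ψ = 0 := by
  refine (Lp.eq_zero_iff_ae_eq_zero).2 <|
    ae_eq_zero_of_forall_integral_inner_pow_mul_expNegS_eq_zero M.vacExp_hasTemperateGrowth
      M.exists_mul_sq_norm_le_vacExp.choose_spec.1 M.exists_mul_sq_norm_le_vacExp.choose_spec.2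
      (Lp.memLp ψ) fun w m => ?_
  obtain ⟨f, hf, hfq⟩ := M.exists_mem_fockSpan_inner_pow_mul_vac w m
  rw [← h f hf, L2.inner_def]
  refine integral_congr_ae ?_
  filter_upwards [f.coeFn_toLp 2 volume] with q (hq : schwToL2 ι f q = f q)
  rw [hq, hfq, RCLike.inner_apply, map_mul, Complex.conj_ofReal, vac_apply, expNegS_apply,
    Complex.conj_ofReal]
  ring

theorem dense_image_fockSpan : Dense (schwToL2 ι '' M.fockSpan) := by
  have h : (M.fockSpan.map (schwToL2 ι)).topologicalClosure = ⊤ := by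
    rw [Submodule.topologicalClosure_eq_top_iff, Submodule.eq_bot_iff]
    intro ψ hψ
    exact M.eq_zero_of_forall_inner_fockSpan fun f hf =>
      (Submodule.mem_orthogonal _ _).1 hψ _ ⟨f, hf, rfl⟩
  exact Submodule.dense_iff_topologicalClosure_eq_top.2 h

theorem exists_hilbertBasis_fockUnit : ∃ b : HilbertBasis (Multiset ι) ℂ (L2 ι),
    ∀ n, b n = schwToL2 ι (M.fockUnit n) := by
  refine ⟨HilbertBasis.mkOfOrthogonalEqBot M.orthonormal_fockUnit ?_, fun n =>
    congrFun (HilbertBasis.coe_mkOfOrthogonalEqBot _ _) n⟩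
  refine (Submodule.eq_bot_iff _).2 fun ψ hψ => M.eq_zero_of_forall_inner_fockSpan fun f hf =>
    (Submodule.mem_orthogonal _ _).1 hψ _ ?_
  have hle : M.fockSpan ≤ (Submodule.span ℂ
      (Set.range fun n => schwToL2 ι (M.fockUnit n))).comap (schwToL2 ι) := by
    refine Submodule.span_le.2 (Set.range_subset_iff.2 fun n => ?_)
    rw [SetLike.mem_coe, Submodule.mem_comap, ← norm_smul_fockUnit, map_smul]
    exact Submodule.smul_mem _ _ (Submodule.subset_span ⟨n, rfl⟩)
  exact hle hf

theorem exists_isUnitaryGroupOf_closedOp_hamS :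
    ∃ U, IsUnitaryGroupOf (closedOp M.hamS) U := by
  obtain ⟨b, hb⟩ := M.exists_hilbertBasis_fockUnit
  refine ⟨_, M.formalAdj_hamS.isUnitaryGroupOf_diagonalGroup b M.fockUnit hb M.energy fun n => ?_⟩
  rw [fockUnit, map_smul, hamS_fock, smul_comm]

end NormalModes

/-! ## Commutators of symmetric operators -/

section Graphs

variable {H : Type*} [NormedAddCommGroup H] [InnerProductSpace ℂ H]

theorem mem_graph_pmapMul (A B : H →ₗ.[ℂ] H) (ψ φ : H) :
    (ψ, φ) ∈ (pmapMul A B).graph ↔ ∃ χ, (ψ, χ) ∈ B.graph ∧ (χ, φ) ∈ A.graph := by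
  constructor
  · intro h
    obtain ⟨⟨_, η, hη, rfl⟩, rfl : (η : H) = ψ, rfl : A ⟨B η, hη⟩ = φ⟩ :=
      (LinearPMap.mem_graph_iff _).1 h
    exact ⟨B η, B.mem_graph η, A.mem_graph ⟨B η, hη⟩⟩
  · rintro ⟨χ, hB, hA⟩
    obtain ⟨η, rfl, rfl⟩ := (LinearPMap.mem_graph_iff _).1 hB
    obtain ⟨θ, hθ : (θ : H) = B η, rfl⟩ := (LinearPMap.mem_graph_iff _).1 hA
    exact (LinearPMap.mem_graph_iff _).2
      ⟨⟨η, η, (hθ ▸ θ.2 : B η ∈ A.domain), rfl⟩, rfl, congrArg A (Subtype.ext hθ.symm)⟩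

theorem mem_graph_pmapComm (A B : H →ₗ.[ℂ] H) (ψ φ : H) :
    (ψ, φ) ∈ (pmapComm A B).graph ↔ ∃ a b, (ψ, a) ∈ (pmapMul A B).graph ∧
      (ψ, b) ∈ (pmapMul B A).graph ∧ φ = a - b := by
  constructor
  · intro h
    obtain ⟨η, rfl : (η : H) = ψ, hφ⟩ := (LinearPMap.mem_graph_iff _).1 h
    exact ⟨_, _, (pmapMul A B).mem_graph ⟨η, η.2.1⟩, (pmapMul B A).mem_graph ⟨η, η.2.2⟩, hφ.symm⟩
  · rintro ⟨a, b, ha, hb, rfl⟩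
    obtain ⟨η, rfl, rfl⟩ := (LinearPMap.mem_graph_iff _).1 ha
    obtain ⟨θ, hθ : (θ : H) = η, rfl⟩ := (LinearPMap.mem_graph_iff _).1 hb
    exact (LinearPMap.mem_graph_iff _).2 ⟨⟨η, η.2, hθ ▸ θ.2⟩, rfl,
      congrArg (pmapMul A B η - ·) (congrArg (pmapMul B A) (Subtype.ext hθ.symm))⟩

theorem mem_graph_toPMap_top (L : H →ₗ[ℂ] H) (ψ φ : H) :
    (ψ, φ) ∈ (L.toPMap ⊤).graph ↔ φ = L ψ := by
  rw [LinearPMap.mem_graph_iff]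
  constructor
  · rintro ⟨η, rfl : (η : H) = ψ, hφ⟩
    exact hφ.symm
  · rintro rfl
    exact ⟨⟨ψ, trivial⟩, rfl, rfl⟩

theorem inner_eq_of_isFormalAdjoint {A B : H →ₗ.[ℂ] H} (h : A.IsFormalAdjoint B) {ψ φ ψ' φ' : H}
    (hA : (ψ, φ) ∈ A.graph) (hB : (ψ', φ') ∈ B.graph) : inner ℂ φ ψ' = inner ℂ ψ φ' := by
  obtain ⟨η, rfl, rfl⟩ := (LinearPMap.mem_graph_iff _).1 hA
  obtain ⟨θ, rfl, rfl⟩ := (LinearPMap.mem_graph_iff _).1 hB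
  exact h η θ

theorem FormalAdj.isFormalAdjoint_closedOp {ι : Type*} [Fintype ι] {A B : Module.End ℂ (Schw ι)}
    (h : FormalAdj A B) : (closedOp A).IsFormalAdjoint (closedOp B) := fun ψ φ => by
  have hc : IsClosed {z : L2 ι × L2 ι | inner ℂ (closedOp A ψ) z.1 = inner ℂ (ψ : L2 ι) z.2} :=
    isClosed_eq (by fun_prop) (by fun_prop)
  refine closure_minimal ?_ hc ((h.symm.mem_graph_closedOp_iff _).1 ((closedOp B).mem_graph φ))
  rintro _ ⟨f, rfl⟩
  change inner ℂ (closedOp A ψ) (schwToL2 ι f) = inner ℂ (ψ : L2 ι) (schwToL2 ι (B f))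
  rw [← inner_conj_symm, h.inner_of_mem_graph ((closedOp A).mem_graph ψ), inner_conj_symm]

theorem inner_eq_neg_of_mem_graph_pmapComm {A B : H →ₗ.[ℂ] H} (hA : A.IsFormalAdjoint A)
    (hB : B.IsFormalAdjoint B) {ψ φ ψ' φ' : H} (h : (ψ, φ) ∈ (pmapComm A B).graph)
    (h' : (ψ', φ') ∈ (pmapComm A B).graph) : inner ℂ φ ψ' = -inner ℂ ψ φ' := by
  simp only [mem_graph_pmapComm, mem_graph_pmapMul] at h h'
  obtain ⟨a, b, ⟨χ, hB₁, hA₁⟩, ⟨ξ, hA₂, hB₂⟩, rfl⟩ := h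
  obtain ⟨a', b', ⟨χ', hB₁', hA₁'⟩, ⟨ξ', hA₂', hB₂'⟩, rfl⟩ := h'
  rw [inner_sub_left, inner_sub_right, inner_eq_of_isFormalAdjoint hA hA₁ hA₂',
    inner_eq_of_isFormalAdjoint hB hB₁ hB₂', inner_eq_of_isFormalAdjoint hB hB₂ hB₁',
    inner_eq_of_isFormalAdjoint hA hA₂ hA₁', neg_sub]

theorem opENorm_pmapComm_le {A B : H →ₗ.[ℂ] H} (hA : A.IsFormalAdjoint A)
    (hB : B.IsFormalAdjoint B) {D : Set H} (hD : Dense D) {c : ℂ}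
    (h : ∀ f ∈ D, (f, c • f) ∈ (pmapComm A B).graph) : opENorm (pmapComm A B) ≤ ‖c‖ₑ := by
  have hscalar (ψ : (pmapComm A B).domain) :
      pmapComm A B ψ = -(starRingEnd ℂ) c • (ψ : H) := by
    refine hD.eq_of_inner_right ℂ fun f hf => ?_
    rw [inner_smul_right, neg_mul, ← inner_smul_left,
      inner_eq_neg_of_mem_graph_pmapComm hA hB (h f hf) ((pmapComm A B).mem_graph ψ), neg_neg]
  rw [opENorm, if_pos (hD.mono fun f hf => LinearPMap.mem_domain_of_mem_graph (h f hf))]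
  refine iSup₂_le fun ψ hψ => ?_
  rw [hscalar, ← ofReal_norm, ← ofReal_norm, norm_smul, norm_neg, RCLike.norm_conj]
  exact ENNReal.ofReal_le_ofReal (mul_le_of_le_one_right (norm_nonneg c) hψ)

theorem isUnitaryGroupOf_expGroup {T : H →ₗ.[ℂ] H} (h : ∃ U, IsUnitaryGroupOf T U) :
    IsUnitaryGroupOf T (expGroup T) := by
  rw [expGroup, dif_pos h]
  exact h.choose_spec

theorem IsUnitaryGroupOf.apply_neg_apply {T : H →ₗ.[ℂ] H} {U : ℝ → H ≃ₗᵢ[ℂ] H}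
    (hU : IsUnitaryGroupOf T U) (t : ℝ) (ψ : H) : U t (U (-t) ψ) = ψ := by
  rw [← Function.comp_apply (f := U t), ← LinearIsometryEquiv.coe_mul, ← hU.map_add,
    add_neg_cancel, hU.map_zero, LinearIsometryEquiv.coe_one, id]

theorem mem_graph_heisenberg {T : H →ₗ.[ℂ] H} (hU : IsUnitaryGroupOf T (expGroup T)) (t : ℝ)
    (A : H →ₗ.[ℂ] H) (ψ φ : H) :
    (ψ, φ) ∈ (heisenberg T t A).graph ↔ (expGroup T t ψ, expGroup T t φ) ∈ A.graph := by
  have hinv (χ : H) : expGroup T (-t) χ = φ ↔ χ = expGroup T t φ := by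
    constructor
    · rintro rfl
      exact (hU.apply_neg_apply t χ).symm
    · rintro rfl
      simpa only [neg_neg] using hU.apply_neg_apply (-t) φ
  simp only [heisenberg, mem_graph_pmapMul, mem_graph_toPMap_top]
  change (∃ χ, (∃ ξ, ξ = expGroup T t ψ ∧ (ξ, χ) ∈ A.graph) ∧ φ = expGroup T (-t) χ) ↔ _
  simp only [exists_eq_left, eq_comm (a := φ), hinv, exists_eq_right]

theorem isFormalAdjoint_heisenberg {T A : H →ₗ.[ℂ] H} (hU : IsUnitaryGroupOf T (expGroup T))
    (t : ℝ) (hA : A.IsFormalAdjoint A) :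
    (heisenberg T t A).IsFormalAdjoint (heisenberg T t A) := fun ψ φ => by
  have hgraph (ψ : (heisenberg T t A).domain) :=
    (mem_graph_heisenberg hU t A _ _).1 ((heisenberg T t A).mem_graph ψ)
  rw [← (expGroup T t).inner_map_map, ← (expGroup T t).inner_map_map (ψ : H)]
  exact inner_eq_of_isFormalAdjoint hA (hgraph ψ) (hgraph φ)

end Graphs

/-! ## The Heisenberg evolution of positions and momenta -/

theorem enorm_ofReal_complex (a : ℝ) : ‖(a : ℂ)‖ₑ = ‖a‖ₑ := by
  rw [← ofReal_norm, ← ofReal_norm, Complex.norm_real]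

theorem enorm_I_mul_ofReal (a : ℝ) : ‖Complex.I * (a : ℂ)‖ₑ = ‖a‖ₑ := by
  rw [enorm_mul, ← ofReal_norm, Complex.norm_I, ENNReal.ofReal_one, one_mul, enorm_ofReal_complex]

namespace NormalModes

variable {ι : Type*} [Fintype ι] [DecidableEq ι] (M : NormalModes ι)

theorem hamS_apply_of_lie_eq_smul {A : Module.End ℂ (Schw ι)} {E e : ℂ} {f : Schw ι}
    (hA : ⁅M.hamS, A⁆ = e • A) (hf : M.hamS f = E • f) : M.hamS (A f) = (E + e) • A f := by
  have h : M.hamS (A f) - A (M.hamS f) = e • A f := LinearMap.congr_fun hA f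
  rw [hf, map_smul, sub_eq_iff_eq_add'] at h
  rw [h, add_smul]

theorem hamS_ann_fock (j : ι) (n : Multiset ι) :
    M.hamS (M.ann j (M.fock n)) = ((M.energy n - 2 * M.ω j : ℝ) : ℂ) • M.ann j (M.fock n) := by
  rw [M.hamS_apply_of_lie_eq_smul (M.lie_hamS_ann j) (M.hamS_fock n)]
  push_cast
  rw [sub_eq_add_neg]

theorem hamS_cre_fock (j : ι) (n : Multiset ι) :
    M.hamS (M.cre j (M.fock n)) = ((M.energy n + 2 * M.ω j : ℝ) : ℂ) • M.cre j (M.fock n) := by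
  rw [M.hamS_apply_of_lie_eq_smul (M.lie_hamS_cre j) (M.hamS_fock n)]
  push_cast
  rfl

theorem exists_apply_ann_cre {U : ℝ → L2 ι ≃ₗᵢ[ℂ] L2 ι}
    (hU : IsUnitaryGroupOf (closedOp M.hamS) U) (t : ℝ) {f : Schw ι} (hf : f ∈ M.fockSpan) :
    ∃ g, U t (schwToL2 ι f) = schwToL2 ι g ∧ ∀ j,
      U t (schwToL2 ι (M.ann j f)) =
        Complex.exp ((2 * t * M.ω j : ℝ) * Complex.I) • schwToL2 ι (M.ann j g) ∧
      U t (schwToL2 ι (M.cre j f)) =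
        Complex.exp (-(2 * t * M.ω j : ℝ) * Complex.I) • schwToL2 ι (M.cre j g) := by
  have heigen {f : Schw ι} {E : ℝ} (h : M.hamS f = (E : ℂ) • f) :
      U t (schwToL2 ι f) = Complex.exp (-(Complex.I * (t * E))) • schwToL2 ι f :=
    hU.apply_eigenvector (by rw [← map_smul, ← h]; exact mem_graph_closedOp _ f) t
  induction hf using Submodule.span_induction with
  | mem f hf =>
    obtain ⟨n, rfl⟩ := hf
    refine ⟨Complex.exp (-(Complex.I * (t * M.energy n))) • M.fock n, ?_, fun j => ⟨?_, ?_⟩⟩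
    · rw [heigen (M.hamS_fock n), map_smul]
    · rw [heigen (M.hamS_ann_fock j n), map_smul, map_smul, smul_smul, ← Complex.exp_add]
      congr 2
      push_cast
      ring
    · rw [heigen (M.hamS_cre_fock j n), map_smul, map_smul, smul_smul, ← Complex.exp_add]
      congr 2
      push_cast
      ring
  | zero => exact ⟨0, by simp, fun j => by simp⟩
  | add f f' _ _ ih ih' =>
    obtain ⟨g, hg, hmodes⟩ := ih
    obtain ⟨g', hg', hmodes'⟩ := ih'
    refine ⟨g + g', by simp only [map_add, hg, hg'], fun j => ?_⟩
    simp only [map_add, hmodes j, hmodes' j, smul_add, and_self]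
  | smul c f _ ih =>
    obtain ⟨g, hg, hmodes⟩ := ih
    refine ⟨c • g, by simp only [map_smul, hg], fun j => ?_⟩
    simp only [map_smul, hmodes j, smul_comm c, and_self]

theorem exists_apply_modePos_modeMom {U : ℝ → L2 ι ≃ₗᵢ[ℂ] L2 ι}
    (hU : IsUnitaryGroupOf (closedOp M.hamS) U) (t : ℝ) {f : Schw ι} (hf : f ∈ M.fockSpan) :
    ∃ g, U t (schwToL2 ι f) = schwToL2 ι g ∧ ∀ j,
      U t (schwToL2 ι (M.modePos j f)) =
        (Real.cos (2 * t * M.ω j) : ℂ) • schwToL2 ι (M.modePos j g) -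
          (((M.ω j)⁻¹ * Real.sin (2 * t * M.ω j) : ℝ) : ℂ) • schwToL2 ι (M.modeMom j g) ∧
      U t (schwToL2 ι (M.modeMom j f)) =
        (Real.cos (2 * t * M.ω j) : ℂ) • schwToL2 ι (M.modeMom j g) +
          ((M.ω j * Real.sin (2 * t * M.ω j) : ℝ) : ℂ) • schwToL2 ι (M.modePos j g) := by
  obtain ⟨g, hg, hmodes⟩ := M.exists_apply_ann_cre hU t hf
  refine ⟨g, hg, fun j => ?_⟩
  obtain ⟨hann, hcre⟩ := hmodes j
  have hω := Complex.ofReal_ne_zero.2 (M.ω_pos j).ne'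
  rw [Complex.exp_mul_I, ← Complex.ofReal_cos, ← Complex.ofReal_sin] at hann
  rw [Complex.exp_mul_I, Complex.cos_neg, Complex.sin_neg, ← Complex.ofReal_cos,
    ← Complex.ofReal_sin] at hcre
  simp only [modePos_eq, modeMom_eq, LinearMap.smul_apply, LinearMap.add_apply,
    LinearMap.sub_apply, map_smul, map_add, map_sub, hann, hcre]
  constructor
  · match_scalars <;> field_simp <;> ring
  · match_scalars <;> field_simp <;>
      linear_combination (-Complex.sin (2 * t * M.ω j)) * Complex.I_sq

/-- The evolved position `τ_t(q_x) = s_x ∑_j O_{x,j} (cos(2tω_j) Q_j + ω_j⁻¹ sin(2tω_j) P_j)`. -/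
noncomputable def evolvedPos (t : ℝ) (x : ι) : Module.End ℂ (Schw ι) :=
  (M.s x : ℂ) • ∑ j, (M.O x j : ℂ) • ((Real.cos (2 * t * M.ω j) : ℂ) • M.modePos j +
    (((M.ω j)⁻¹ * Real.sin (2 * t * M.ω j) : ℝ) : ℂ) • M.modeMom j)

/-- The evolved momentum `τ_t(p_x) = s_x⁻¹ ∑_j O_{x,j} (cos(2tω_j) P_j - ω_j sin(2tω_j) Q_j)`. -/
noncomputable def evolvedMom (t : ℝ) (x : ι) : Module.End ℂ (Schw ι) :=
  ((M.s x)⁻¹ : ℂ) • ∑ j, (M.O x j : ℂ) • ((Real.cos (2 * t * M.ω j) : ℂ) • M.modeMom j -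
    ((M.ω j * Real.sin (2 * t * M.ω j) : ℝ) : ℂ) • M.modePos j)

theorem mem_graph_heisenberg_evolved (t : ℝ) (x : ι) {f : Schw ι} (hf : f ∈ M.fockSpan) :
    (schwToL2 ι f, schwToL2 ι (M.evolvedPos t x f)) ∈
        (heisenberg (closedOp M.hamS) t (posOp x)).graph ∧
      (schwToL2 ι f, schwToL2 ι (M.evolvedMom t x f)) ∈
        (heisenberg (closedOp M.hamS) t (momOp x)).graph := by
  have hU := isUnitaryGroupOf_expGroup M.exists_isUnitaryGroupOf_closedOp_hamS
  obtain ⟨g, hg, hmodes⟩ := M.exists_apply_modePos_modeMom hU t hf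
  have hrot (j : ι) := congrArg ((↑) : ℝ → ℂ) (Real.sin_sq_add_cos_sq (2 * t * M.ω j))
  have hω (j : ι) := Complex.ofReal_ne_zero.2 (M.ω_pos j).ne'
  push_cast at hrot
  simp only [mem_graph_heisenberg hU, hg]
  constructor
  · suffices expGroup (closedOp M.hamS) t (schwToL2 ι (M.evolvedPos t x f)) =
        schwToL2 ι (posS x g) from this ▸ mem_graph_closedOp (posS x) g
    simp only [evolvedPos, M.posS_eq_sum_modePos x, LinearMap.smul_apply, LinearMap.sum_apply,
      LinearMap.add_apply, map_smul, map_sum, map_add, hmodes]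
    congr! 3 with j
    push_cast
    linear_combination (norm := skip) hrot j • schwToL2 ι (M.modePos j g)
    match_scalars <;> field_simp [hω j] <;> ring
  · suffices expGroup (closedOp M.hamS) t (schwToL2 ι (M.evolvedMom t x f)) =
        schwToL2 ι (momS x g) from this ▸ mem_graph_closedOp (momS x) g
    simp only [evolvedMom, M.momS_eq_sum_modeMom x, LinearMap.smul_apply, LinearMap.sum_apply,
      LinearMap.sub_apply, map_smul, map_sum, map_sub, hmodes]
    congr! 3 with j
    push_cast
    linear_combination (norm := skip) hrot j • schwToL2 ι (M.modeMom j g)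
    match_scalars <;> field_simp [hω j] <;> ring

/-- The matrix `O φ(ω) Oᵀ`, where `ω` is the diagonal matrix of the frequencies. -/
noncomputable def kernel (φ : ℝ → ℝ) (x y : ι) : ℝ := ∑ j, M.O x j * φ (M.ω j) * M.O y j

theorem lie_evolvedPos_posS (t : ℝ) (x y : ι) : ⁅M.evolvedPos t x, posS y⁆ =
    (-(Complex.I * (M.s x * M.s y * M.kernel (fun w => w⁻¹ * Real.sin (2 * t * w)) x y : ℝ))) •
      1 := by
  simp only [evolvedPos, smul_lie, sum_lie, add_lie, lie_modePos_posS, lie_modeMom_posS, smul_zero,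
    zero_add, smul_smul, ← Finset.sum_smul, kernel]
  congr 1
  push_cast
  simp only [Finset.mul_sum, ← Finset.sum_neg_distrib]
  exact Finset.sum_congr rfl fun j _ => by ring

theorem lie_evolvedPos_momS (t : ℝ) (x y : ι) : ⁅M.evolvedPos t x, momS y⁆ =
    (Complex.I * (M.s x / M.s y * M.kernel (fun w => Real.cos (2 * t * w)) x y : ℝ)) • 1 := by
  simp only [evolvedPos, smul_lie, sum_lie, add_lie, lie_modePos_momS, lie_modeMom_momS, smul_zero,
    add_zero, smul_smul, ← Finset.sum_smul, kernel]
  congr 1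
  push_cast
  simp only [Finset.mul_sum]
  exact Finset.sum_congr rfl fun j _ => by ring

theorem lie_evolvedMom_posS (t : ℝ) (x y : ι) : ⁅M.evolvedMom t x, posS y⁆ =
    (-(Complex.I * (M.s y / M.s x * M.kernel (fun w => Real.cos (2 * t * w)) x y : ℝ))) • 1 := by
  simp only [evolvedMom, smul_lie, sum_lie, sub_lie, lie_modePos_posS, lie_modeMom_posS, smul_zero,
    sub_zero, smul_smul, ← Finset.sum_smul, kernel]
  congr 1
  push_cast
  simp only [Finset.mul_sum, ← Finset.sum_neg_distrib]
  exact Finset.sum_congr rfl fun j _ => by ring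

theorem lie_evolvedMom_momS (t : ℝ) (x y : ι) : ⁅M.evolvedMom t x, momS y⁆ =
    (-(Complex.I * ((M.s x * M.s y)⁻¹ *
      M.kernel (fun w => w * Real.sin (2 * t * w)) x y : ℝ))) • 1 := by
  simp only [evolvedMom, smul_lie, sum_lie, sub_lie, lie_modePos_momS, lie_modeMom_momS, smul_smul,
    smul_zero, zero_sub, ← neg_smul, ← Finset.sum_smul, kernel]
  congr 1
  push_cast
  simp only [Finset.mul_sum, ← Finset.sum_neg_distrib]
  exact Finset.sum_congr rfl fun j _ => by ring

theorem opENorm_pmapComm_heisenberg_le (t : ℝ) {A At B : Module.End ℂ (Schw ι)}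
    (hA : FormalAdj A A) (hB : FormalAdj B B) (hB_mem : ∀ f ∈ M.fockSpan, B f ∈ M.fockSpan)
    (hAt : ∀ f ∈ M.fockSpan, (schwToL2 ι f, schwToL2 ι (At f)) ∈
      (heisenberg (closedOp M.hamS) t (closedOp A)).graph)
    {c : ℂ} (hc : ⁅At, B⁆ = c • 1) :
    opENorm (pmapComm (heisenberg (closedOp M.hamS) t (closedOp A)) (closedOp B)) ≤ ‖c‖ₑ := by
  have hU := isUnitaryGroupOf_expGroup M.exists_isUnitaryGroupOf_closedOp_hamS
  refine opENorm_pmapComm_le (isFormalAdjoint_heisenberg hU t hA.isFormalAdjoint_closedOp)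
    hB.isFormalAdjoint_closedOp M.dense_image_fockSpan ?_
  rintro _ ⟨f, hf, rfl⟩
  have hcf : At (B f) - B (At f) = c • f := LinearMap.congr_fun hc f
  simp only [mem_graph_pmapComm, mem_graph_pmapMul]
  exact ⟨_, _, ⟨_, mem_graph_closedOp B f, hAt _ (hB_mem f hf)⟩,
    ⟨_, hAt f hf, mem_graph_closedOp B _⟩, by rw [← map_sub, hcf, map_smul]⟩

theorem opENorm_pos_pos_le (t : ℝ) (x y : ι) :
    opENorm (pmapComm (heisenberg (closedOp M.hamS) t (posOp x)) (posOp y)) ≤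
      ‖M.s x * M.s y * M.kernel (fun w => w⁻¹ * Real.sin (2 * t * w)) x y‖ₑ := by
  rw [← enorm_I_mul_ofReal, ← enorm_neg]
  exact M.opENorm_pmapComm_heisenberg_le t (formalAdj_posS x) (formalAdj_posS y)
    (fun _ => M.posS_mem_fockSpan y) (fun _ hf => (M.mem_graph_heisenberg_evolved t x hf).1)
    (M.lie_evolvedPos_posS t x y)

theorem opENorm_pos_mom_le (t : ℝ) (x y : ι) :
    opENorm (pmapComm (heisenberg (closedOp M.hamS) t (posOp x)) (momOp y)) ≤
      ‖M.s x / M.s y * M.kernel (fun w => Real.cos (2 * t * w)) x y‖ₑ := by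
  rw [← enorm_I_mul_ofReal]
  exact M.opENorm_pmapComm_heisenberg_le t (formalAdj_posS x) (formalAdj_momS y)
    (fun _ => M.momS_mem_fockSpan y) (fun _ hf => (M.mem_graph_heisenberg_evolved t x hf).1)
    (M.lie_evolvedPos_momS t x y)

theorem opENorm_mom_pos_le (t : ℝ) (x y : ι) :
    opENorm (pmapComm (heisenberg (closedOp M.hamS) t (momOp x)) (posOp y)) ≤
      ‖M.s y / M.s x * M.kernel (fun w => Real.cos (2 * t * w)) x y‖ₑ := by
  rw [← enorm_I_mul_ofReal, ← enorm_neg]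
  exact M.opENorm_pmapComm_heisenberg_le t (formalAdj_momS x) (formalAdj_posS y)
    (fun _ => M.posS_mem_fockSpan y) (fun _ hf => (M.mem_graph_heisenberg_evolved t x hf).2)
    (M.lie_evolvedMom_posS t x y)

theorem opENorm_mom_mom_le (t : ℝ) (x y : ι) :
    opENorm (pmapComm (heisenberg (closedOp M.hamS) t (momOp x)) (momOp y)) ≤
      ‖(M.s x * M.s y)⁻¹ * M.kernel (fun w => w * Real.sin (2 * t * w)) x y‖ₑ := by
  rw [← enorm_I_mul_ofReal, ← enorm_neg]
  exact M.opENorm_pmapComm_heisenberg_le t (formalAdj_momS x) (formalAdj_momS y)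
    (fun _ => M.momS_mem_fockSpan y) (fun _ hf => (M.mem_graph_heisenberg_evolved t x hf).2)
    (M.lie_evolvedMom_momS t x y)

end NormalModes

/-! ## The oscillator system in normal modes -/

namespace NormalModes

variable {ι : Type*} [Fintype ι] [DecidableEq ι] (M : NormalModes ι)

theorem sum_modeMom_sq : ∑ j, M.modeMom j ^ 2 = ∑ x, ((M.s x ^ 2 : ℝ) : ℂ) • momS x ^ 2 := by
  have hsq (j : ι) : M.modeMom j ^ 2 = ∑ x, ∑ y,
      (((M.O x j * M.O y j) * (M.s x * M.s y) : ℝ) : ℂ) • (momS x * momS y) := by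
    simp only [modeMom, pow_two, Finset.sum_mul_sum, smul_mul_smul_comm, ← Complex.ofReal_mul,
      mul_mul_mul_comm]
  simp only [hsq]
  rw [Finset.sum_comm]
  refine Finset.sum_congr rfl fun x _ => ?_
  rw [Finset.sum_comm]
  simp only [← Finset.sum_smul, ← Complex.ofReal_sum, ← Finset.sum_mul, sum_row, ite_mul, one_mul,
    zero_mul, apply_ite Complex.ofReal, Complex.ofReal_zero, ite_smul, zero_smul,
    Finset.sum_ite_eq, Finset.mem_univ, if_true, pow_two]

theorem sum_modePos_sq : ∑ j, ((M.ω j ^ 2 : ℝ) : ℂ) • M.modePos j ^ 2 =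
    ∑ x, ∑ y, ((M.kernel (fun w => w ^ 2) x y / (M.s x * M.s y) : ℝ) : ℂ) •
      (posS x * posS y) := by
  have hsq (j : ι) : ((M.ω j ^ 2 : ℝ) : ℂ) • M.modePos j ^ 2 = ∑ x, ∑ y,
      ((M.O x j * M.ω j ^ 2 * M.O y j / (M.s x * M.s y) : ℝ) : ℂ) • (posS x * posS y) := by
    simp only [modePos, pow_two (∑ x, _ • posS x), Finset.sum_mul_sum, smul_mul_smul_comm,
      Finset.smul_sum, smul_smul, ← Complex.ofReal_mul, div_mul_div_comm]
    refine Finset.sum_congr rfl fun x _ => Finset.sum_congr rfl fun y _ => ?_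
    congr 2
    ring
  simp only [hsq]
  rw [Finset.sum_comm]
  refine Finset.sum_congr rfl fun x _ => ?_
  rw [Finset.sum_comm]
  simp only [← Finset.sum_smul, ← Complex.ofReal_sum, ← Finset.sum_div, kernel]

theorem hamS_eq : M.hamS = ∑ x, ((M.s x ^ 2 : ℝ) : ℂ) • momS x ^ 2 +
    ∑ x, ∑ y, ((M.kernel (fun w => w ^ 2) x y / (M.s x * M.s y) : ℝ) : ℂ) •
      (posS x * posS y) := by
  rw [hamS, Finset.sum_add_distrib, sum_modeMom_sq, sum_modePos_sq]

end NormalModes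

section SymmetricMatrix

variable {n : Type*} [Fintype n] [DecidableEq n] {A : Matrix n n ℝ} (hA : A.IsHermitian)

theorem matFun_apply (φ : ℝ → ℂ) (x y : n) : matFun hA φ x y =
    ∑ j, ((hA.eigenvectorUnitary : Matrix n n ℝ) x j : ℂ) * φ (hA.eigenvalues j) *
      ((hA.eigenvectorUnitary : Matrix n n ℝ) y j : ℂ) := by
  rw [matFun, Matrix.mul_apply]
  simp only [Matrix.mul_diagonal, Matrix.map_apply, Matrix.transpose_apply]

theorem sum_eigenvectorUnitary_mul_eigenvalues_mul (x y : n) :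
    ∑ j, (hA.eigenvectorUnitary : Matrix n n ℝ) x j * hA.eigenvalues j *
      (hA.eigenvectorUnitary : Matrix n n ℝ) y j = A x y := by
  conv_rhs => rw [hA.spectral_theorem, Unitary.conjStarAlgAut_apply, Matrix.mul_apply]
  refine Finset.sum_congr rfl fun j _ => ?_
  rw [Matrix.mul_diagonal, Matrix.star_apply, star_trivial, Function.comp_apply,
    RCLike.ofReal_real_eq_id, id_eq]

theorem abs_eigenvalues_le_of_sum_abs_le {K : ℝ} (hK : ∀ x, ∑ y, |A x y| ≤ K) (j : n) :
    |hA.eigenvalues j| ≤ K := by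
  have hev : Module.End.HasEigenvalue (Matrix.toLin' A) (hA.eigenvalues j) := by
    rw [Module.End.hasEigenvalue_iff_mem_spectrum, Matrix.spectrum_toLin']
    exact hA.eigenvalues_mem_spectrum_real j
  obtain ⟨k, hk⟩ := eigenvalue_mem_ball hev
  rw [Metric.mem_closedBall, Real.dist_eq] at hk
  simp only [Real.norm_eq_abs] at hk
  have hrow : |A k k| + ∑ y ∈ Finset.univ.erase k, |A k y| ≤ K :=
    (Finset.add_sum_erase _ _ (Finset.mem_univ k)).trans_le (hK k)
  linarith [abs_sub_abs_le_abs_sub (hA.eigenvalues j) (A k k)]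

end SymmetricMatrix

theorem dist1_comm {d : ℕ} (x y : Fin d → ℤ) : dist1 x y = dist1 y x := by
  simp only [dist1, abs_sub_comm]

theorem card_dist1_eq_one_le {d L : ℕ} (x : box d L) :
    (Finset.univ.filter fun y : box d L => dist1 (x : Fin d → ℤ) y = 1).card ≤ 3 ^ d := by
  calc (Finset.univ.filter fun y : box d L => dist1 (x : Fin d → ℤ) y = 1).card
      ≤ (Finset.Icc (fun i => (x : Fin d → ℤ) i - 1) fun i => (x : Fin d → ℤ) i + 1).card := by
        refine Finset.card_le_card_of_injOn Subtype.val (fun y hy => ?_)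
          Subtype.val_injective.injOn
        have hxy : dist1 (x : Fin d → ℤ) y = 1 := by simpa using hy
        have hcoord (i : Fin d) : |(x : Fin d → ℤ) i - (y : Fin d → ℤ) i| ≤ 1 :=
          hxy ▸ Finset.single_le_sum (f := fun i => |(x : Fin d → ℤ) i - (y : Fin d → ℤ) i|)
            (fun i _ => abs_nonneg _) (Finset.mem_univ i)
        rw [Finset.mem_coe, Finset.mem_Icc]
        constructor <;> intro i <;> have := abs_le.1 (hcoord i) <;> dsimp only <;> omega
    _ = ∏ _i : Fin d, 3 := by
        rw [Pi.card_Icc]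
        refine Finset.prod_congr rfl fun i _ => ?_
        rw [Int.card_Icc]
        omega
    _ = 3 ^ d := by rw [Finset.prod_const, Finset.card_univ, Fintype.card_fin]

namespace OscParams

variable {d : ℕ} (p : OscParams d)

/-- The coupling `λ_{x,y}`, extended by zero to pairs of sites that are not neighbours. -/
noncomputable def coup (L : ℕ) (x y : box d L) : ℝ :=
  if dist1 (x : Fin d → ℤ) y = 1 then p.lam s((x : Fin d → ℤ), y) else 0

theorem coup_comm (L : ℕ) (x y : box d L) : p.coup L x y = p.coup L y x := by
  rw [coup, coup, dist1_comm, Sym2.eq_swap]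

theorem h0_apply (L : ℕ) (x y : box d L) : p.h0 L x y =
    (if x = y then p.k x / 2 + ∑ u, p.coup L x u else 0) - p.coup L x y := by
  by_cases hxy : x = y
  · subst hxy
    have hself : p.coup L x x = 0 := by simp [coup, dist1]
    rw [hself, h0, if_pos rfl, if_pos rfl, sub_zero]
    simp only [coup, dist1_comm (x : Fin d → ℤ)]
  · rw [h0, if_neg hxy, if_neg hxy, coup]
    split_ifs <;> simp

theorem coup_smul_posS_sub_sq (L : ℕ) (x y : box d L) :
    (p.coup L x y : ℂ) • (posS x - posS y) ^ 2 =
      (p.coup L x y : ℂ) • posS x ^ 2 + (p.coup L x y : ℂ) • posS y ^ 2 -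
        (2 * p.coup L x y : ℂ) • (posS x * posS y) := by
  have hcomm : posS y * posS x = posS x * posS y :=
    sub_eq_zero.1 ((Ring.lie_def _ _).symm.trans (lie_posS_posS y x))
  rw [pow_two, sub_mul, mul_sub, mul_sub, hcomm, ← pow_two, ← pow_two]
  module

theorem half_smul_sum_coup_smul_posS_sub_sq (L : ℕ) :
    (1 / 2 : ℂ) • ∑ x, ∑ y, (p.coup L x y : ℂ) • (posS x - posS y) ^ 2 =
      ∑ x, ((∑ u, p.coup L x u : ℝ) : ℂ) • posS x ^ 2 -
        ∑ x, ∑ y, (p.coup L x y : ℂ) • (posS x * posS y) := by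
  have hswap : ∑ x, ∑ y, (p.coup L x y : ℂ) • posS y ^ 2 =
      ∑ x, ∑ y, (p.coup L x y : ℂ) • posS x ^ 2 := by
    rw [Finset.sum_comm]
    simp only [p.coup_comm L]
  simp only [coup_smul_posS_sub_sq, Finset.sum_sub_distrib, Finset.sum_add_distrib, hswap, mul_smul,
    ← Finset.smul_sum, Complex.ofReal_sum, Finset.sum_smul]
  module

theorem hamS_eq (L : ℕ) : p.hamS L = ∑ x : box d L, ((1 / (2 * p.m x) : ℝ) : ℂ) • momS x ^ 2 +
    ∑ x, ∑ y, ((p.h0 L x y : ℝ) : ℂ) • (posS x * posS y) := by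
  have hcoup (x y : box d L) : (if dist1 (x : Fin d → ℤ) y = 1 then
      ((p.lam s((x : Fin d → ℤ), y) : ℝ) : ℂ) • (posS x - posS y) ^ 2 else 0) =
      (p.coup L x y : ℂ) • (posS x - posS y) ^ 2 := by
    rw [coup]
    split_ifs <;> simp
  have hh0 (x y : box d L) : ((p.h0 L x y : ℝ) : ℂ) • (posS x * posS y) =
      (if x = y then ((p.k x / 2 + ∑ u, p.coup L x u : ℝ) : ℂ) • (posS x * posS y) else 0) -
        (p.coup L x y : ℂ) • (posS x * posS y) := by
    rw [h0_apply, Complex.ofReal_sub, sub_smul]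
    split_ifs <;> simp
  simp only [hamS, hcoup, half_smul_sum_coup_smul_posS_sub_sq, hh0, Finset.sum_sub_distrib,
    Finset.sum_add_distrib, Finset.sum_ite_eq, Finset.mem_univ, if_true, Complex.ofReal_add,
    add_smul, ← pow_two]
  abel

variable {p}

theorem sqrtMu_pos (hm : ∀ x, 0 < p.m x) (x : Fin d → ℤ) : 0 < √(1 / (2 * p.m x)) :=
  Real.sqrt_pos.2 (by have := hm x; positivity)

theorem h_apply (L : ℕ) (x y : box d L) :
    p.h L x y = √(1 / (2 * p.m x)) * p.h0 L x y * √(1 / (2 * p.m y)) := by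
  rw [h, sqrtMu, Matrix.mul_diagonal, Matrix.diagonal_mul]

theorem h_posDef (hm : ∀ x, 0 < p.m x) {L : ℕ} (h0 : (p.h0 L).PosDef) : (p.h L).PosDef := by
  have hsymm : (p.sqrtMu L).conjTranspose = p.sqrtMu L := by
    rw [sqrtMu, Matrix.diagonal_conjTranspose, star_trivial]
  have hinj : Function.Injective (p.sqrtMu L).mulVec := fun v w hvw => funext fun x =>
    mul_left_cancel₀ (sqrtMu_pos hm x).ne' <| by
      simpa only [sqrtMu, Matrix.mulVec_diagonal] using congrFun hvw x
  have hpos := h0.conjTranspose_mul_mul_same hinj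
  rwa [hsymm] at hpos

/-- The normal modes of the oscillator system: the orthogonal matrix diagonalizes `h_L`, the
squares of the frequencies are the eigenvalues of `h_L`, and the scales are the diagonal entries
of `μ^{1/2}`. -/
noncomputable def modes (hm : ∀ x, 0 < p.m x) {L : ℕ} (h0 : (p.h0 L).PosDef) :
    NormalModes (box d L) where
  O := (p.h_isHermitian L).eigenvectorUnitary
  s x := √(1 / (2 * p.m x))
  ω j := √((p.h_isHermitian L).eigenvalues j)
  s_pos x := sqrtMu_pos hm x
  ω_pos j := Real.sqrt_pos.2 ((h_posDef hm h0).eigenvalues_pos j)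
  orth := by
    have := Unitary.coe_star_mul_self (p.h_isHermitian L).eigenvectorUnitary
    rwa [Matrix.star_eq_conjTranspose, Matrix.conjTranspose_eq_transpose_of_trivial] at this

theorem modes_kernel_sq (hm : ∀ x, 0 < p.m x) {L : ℕ} (h0 : (p.h0 L).PosDef) (x y : box d L) :
    (modes hm h0).kernel (fun w => w ^ 2) x y = p.h L x y := by
  simp only [NormalModes.kernel, modes, Real.sq_sqrt ((h_posDef hm h0).eigenvalues_pos _).le,
    sum_eigenvectorUnitary_mul_eigenvalues_mul]

theorem ham_eq_closedOp_modes (hm : ∀ x, 0 < p.m x) {L : ℕ} (h0 : (p.h0 L).PosDef) :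
    p.ham L = closedOp (modes hm h0).hamS := by
  have hkin (x : box d L) : 1 / (2 * p.m x) = (modes hm h0).s x ^ 2 :=
    (Real.sq_sqrt (by have := hm x; positivity)).symm
  have hpot (x y : box d L) : p.h0 L x y =
      (modes hm h0).kernel (fun w => w ^ 2) x y / ((modes hm h0).s x * (modes hm h0).s y) := by
    have hx := (modes hm h0).s_pos x
    have hy := (modes hm h0).s_pos y
    rw [modes_kernel_sq, h_apply, eq_div_iff (mul_pos hx hy).ne']
    simp only [modes]
    ring
  simp only [ham, hamS_eq, NormalModes.hamS_eq, hkin, hpot]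

end OscParams

/-! ## Correlators -/

theorem exists_abs_le_one_and_eq_mul {X : Type*} (f g : X → ℝ) :
    ∃ u : X → ℝ, (∀ s, |u s| ≤ 1) ∧ ∀ s, |f s| ≤ g s → f s = g s * u s := by
  refine ⟨fun s => if |f s| ≤ g s then f s / g s else 0, fun s => ?_, fun s hs => ?_⟩
  · dsimp only
    split_ifs with hs
    · have hg : 0 ≤ g s := (abs_nonneg _).trans hs
      rw [abs_div, abs_of_nonneg hg]
      exact div_le_one_of_le₀ hs hg
    · rw [abs_zero]
      exact zero_le_one
  · dsimp only
    rw [if_pos hs, mul_div_cancel_of_imp' fun hg => abs_nonpos_iff.1 (hg ▸ hs)]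

namespace OscParams

variable {d : ℕ} {p : OscParams d}

theorem enorm_modes_kernel_rpow_le (hm : ∀ x, 0 < p.m x) {L : ℕ} (h0 : (p.h0 L).PosDef)
    {α r K : ℝ} (hr : 0 ≤ r) {φ : ℝ → ℝ}
    (hφ : ∀ j, |φ (√((p.h_isHermitian L).eigenvalues j))| ≤
      K * (p.h_isHermitian L).eigenvalues j ^ α) (x y : box d L) :
    ‖(modes hm h0).kernel φ x y‖ₑ ^ r ≤ ‖K‖ₑ ^ r * p.correlator α r L x y := by
  -- `K h_L^α u(h_L) = φ(√h_L)`, where `|u| ≤ 1` holds off the spectrum as well.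
  obtain ⟨u, hu, hφu⟩ := exists_abs_le_one_and_eq_mul (fun s => φ √s) (fun s => K * s ^ α)
  have hkernel : (((modes hm h0).kernel φ x y : ℝ) : ℂ) =
      K * matFun (p.h_isHermitian L) (fun s => ((s ^ α : ℝ) : ℂ) * u s) x y := by
    simp only [NormalModes.kernel, modes, matFun_apply, hφu _ (hφ _), Finset.mul_sum]
    push_cast
    exact Finset.sum_congr rfl fun j _ => by ring
  have henorm : ‖(modes hm h0).kernel φ x y‖ₑ =
      ‖K‖ₑ * ‖matFun (p.h_isHermitian L) (fun s => ((s ^ α : ℝ) : ℂ) * u s) x y‖ₑ := by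
    rw [← enorm_ofReal_complex, hkernel, enorm_mul, enorm_ofReal_complex]
  rw [henorm, ENNReal.mul_rpow_of_nonneg _ _ hr]
  gcongr
  exact le_iSup₂ (f := fun (u : ℝ → ℂ) (_ : ∀ s, ‖u s‖ ≤ 1) =>
    ‖matFun (p.h_isHermitian L) (fun s => ((s ^ α : ℝ) : ℂ) * u s) x y‖ₑ ^ r) _
    fun s => (Complex.norm_real _).trans_le (hu s)

theorem enorm_mul_modes_kernel_rpow_le (hm : ∀ x, 0 < p.m x) {L : ℕ} (h0 : (p.h0 L).PosDef)
    {α r c C K : ℝ} (hr : 0 ≤ r) (hc : |c| ≤ C) {φ : ℝ → ℝ}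
    (hφ : ∀ j, |φ (√((p.h_isHermitian L).eigenvalues j))| ≤
      K * (p.h_isHermitian L).eigenvalues j ^ α) (x y : box d L) :
    ‖c * (modes hm h0).kernel φ x y‖ₑ ^ r ≤ ‖C * K‖ₑ ^ r * p.correlator α r L x y := by
  have hcC : ‖c‖ₑ ≤ ‖C‖ₑ := enorm_le_iff_norm_le.2 (hc.trans (le_abs_self C))
  rw [enorm_mul, enorm_mul, ENNReal.mul_rpow_of_nonneg _ _ hr, ENNReal.mul_rpow_of_nonneg _ _ hr,
    mul_assoc]
  gcongr
  exact enorm_modes_kernel_rpow_le hm h0 hr hφ x y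

/-! ## Bounds uniform in the volume -/

/-- A bound on the spectrum of `h_L` that does not depend on `L`. -/
noncomputable def specBound (d : ℕ) (mmin kmax lammax : ℝ) : ℝ :=
  1 / (2 * mmin) * (kmax / 2 + 2 * (3 ^ d * |lammax|))

namespace Bounded

variable {mmin mmax kmax lammax : ℝ} (hb : p.Bounded mmin mmax kmax lammax)
include hb

theorem coup_nonneg (L : ℕ) (x y : box d L) : 0 ≤ p.coup L x y := by
  rw [coup]
  split_ifs with hxy
  · exact (hb.lam_mem x y hxy).1
  · exact le_rfl

theorem sum_coup_le (L : ℕ) (x : box d L) : ∑ y, p.coup L x y ≤ 3 ^ d * |lammax| := by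
  simp only [coup]
  calc ∑ y : box d L, (if dist1 (x : Fin d → ℤ) y = 1 then p.lam s((x : Fin d → ℤ), y) else 0)
      ≤ (Finset.univ.filter fun y : box d L => dist1 (x : Fin d → ℤ) y = 1).card • |lammax| := by
        rw [← Finset.sum_filter]
        exact Finset.sum_le_card_nsmul _ _ _ fun y hy =>
          (hb.lam_mem x y (Finset.mem_filter.1 hy).2).2.trans (le_abs_self _)
    _ ≤ 3 ^ d * |lammax| := by
        rw [nsmul_eq_mul]
        gcongr
        exact_mod_cast card_dist1_eq_one_le x

theorem sum_abs_h0_le (L : ℕ) (x : box d L) :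
    ∑ y, |p.h0 L x y| ≤ kmax / 2 + 2 * (3 ^ d * |lammax|) := by
  have hentry (y : box d L) : |p.h0 L x y| ≤
      (if x = y then p.k x / 2 + ∑ u, p.coup L x u else 0) + p.coup L x y := by
    rw [h0_apply]
    refine (abs_sub _ _).trans_eq ?_
    rw [abs_of_nonneg (hb.coup_nonneg L x y), abs_of_nonneg]
    split_ifs
    · exact add_nonneg (div_nonneg (hb.k_mem x).1 zero_le_two)
        (Finset.sum_nonneg fun u _ => hb.coup_nonneg L x u)
    · exact le_rfl
  calc ∑ y, |p.h0 L x y|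
      ≤ ∑ y, ((if x = y then p.k x / 2 + ∑ u, p.coup L x u else 0) + p.coup L x y) :=
        Finset.sum_le_sum fun y _ => hentry y
    _ = p.k x / 2 + 2 * ∑ y, p.coup L x y := by
        rw [Finset.sum_add_distrib, Finset.sum_ite_eq, if_pos (Finset.mem_univ x)]
        ring
    _ ≤ kmax / 2 + 2 * (3 ^ d * |lammax|) := by
        gcongr
        · exact (hb.k_mem x).2
        · exact hb.sum_coup_le L x

variable (hmmin : 0 < mmin)
include hmmin

theorem m_pos (x : Fin d → ℤ) : 0 < p.m x := hmmin.trans_le (hb.m_mem x).1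

theorem mmax_pos : 0 < mmax := (hb.m_pos hmmin 0).trans_le (hb.m_mem 0).2

theorem sqrtMu_le (x : Fin d → ℤ) : √(1 / (2 * p.m x)) ≤ √(1 / (2 * mmin)) := by
  have := (hb.m_mem x).1
  gcongr

theorem le_sqrtMu (x : Fin d → ℤ) : √(1 / (2 * mmax)) ≤ √(1 / (2 * p.m x)) := by
  have hm := hb.m_pos hmmin x
  have := (hb.m_mem x).2
  gcongr

theorem sqrtMu_mul_sqrtMu_le (x y : Fin d → ℤ) :
    √(1 / (2 * p.m x)) * √(1 / (2 * p.m y)) ≤ 1 / (2 * mmin) := by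
  rw [← Real.mul_self_sqrt (show 0 ≤ 1 / (2 * mmin) by positivity)]
  exact mul_le_mul (hb.sqrtMu_le hmmin x) (hb.sqrtMu_le hmmin y) (Real.sqrt_nonneg _)
    (Real.sqrt_nonneg _)

theorem sqrtMu_div_sqrtMu_le (x y : Fin d → ℤ) :
    √(1 / (2 * p.m x)) / √(1 / (2 * p.m y)) ≤ √(1 / (2 * mmin)) / √(1 / (2 * mmax)) := by
  have hmmax := hb.mmax_pos hmmin
  exact div_le_div₀ (Real.sqrt_nonneg _) (hb.sqrtMu_le hmmin x) (by positivity)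
    (hb.le_sqrtMu hmmin y)

theorem inv_sqrtMu_mul_sqrtMu_le (x y : Fin d → ℤ) :
    (√(1 / (2 * p.m x)) * √(1 / (2 * p.m y)))⁻¹ ≤ 2 * mmax := by
  have hmmax := hb.mmax_pos hmmin
  calc (√(1 / (2 * p.m x)) * √(1 / (2 * p.m y)))⁻¹
      ≤ (√(1 / (2 * mmax)) * √(1 / (2 * mmax)))⁻¹ :=
        inv_anti₀ (by positivity) (mul_le_mul (hb.le_sqrtMu hmmin x) (hb.le_sqrtMu hmmin y)
          (Real.sqrt_nonneg _) (Real.sqrt_nonneg _))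
    _ = 2 * mmax := by rw [Real.mul_self_sqrt (by positivity), one_div, inv_inv]

theorem sum_abs_h_le (L : ℕ) (x : box d L) : ∑ y, |p.h L x y| ≤ specBound d mmin kmax lammax := by
  have hentry (y : box d L) : |p.h L x y| ≤ 1 / (2 * mmin) * |p.h0 L x y| := by
    rw [h_apply, abs_mul, abs_mul, abs_of_nonneg (Real.sqrt_nonneg _),
      abs_of_nonneg (Real.sqrt_nonneg _), mul_right_comm]
    gcongr
    exact hb.sqrtMu_mul_sqrtMu_le hmmin x y
  calc ∑ y, |p.h L x y| ≤ ∑ y, 1 / (2 * mmin) * |p.h0 L x y| :=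
        Finset.sum_le_sum fun y _ => hentry y
    _ = 1 / (2 * mmin) * ∑ y, |p.h0 L x y| := (Finset.mul_sum _ _ _).symm
    _ ≤ specBound d mmin kmax lammax := by
        rw [specBound]
        gcongr
        exact hb.sum_abs_h0_le L x

theorem eigenvalues_h_le (L : ℕ) (j : box d L) :
    (p.h_isHermitian L).eigenvalues j ≤ specBound d mmin kmax lammax :=
  (le_abs_self _).trans (abs_eigenvalues_le_of_sum_abs_le _ (hb.sum_abs_h_le hmmin L) j)

/-! ## Commutator norms -/

variable {L : ℕ} (h0 : (p.h0 L).PosDef) (x y : box d L) (t : ℝ) {r : ℝ} (hr : 0 ≤ r)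
include h0 hr

theorem commNorm_pos_pos_rpow_le : p.commNorm L t (posOp x) (posOp y) ^ r ≤
    ‖1 / (2 * mmin)‖ₑ ^ r * p.correlator (-1 / 2) r L x y := by
  have hm := hb.m_pos hmmin
  have hsin (j : box d L) : |(√((p.h_isHermitian L).eigenvalues j))⁻¹ *
      Real.sin (2 * t * √((p.h_isHermitian L).eigenvalues j))| ≤
        1 * (p.h_isHermitian L).eigenvalues j ^ (-1 / 2 : ℝ) := by
    rw [neg_div, Real.rpow_neg ((h_posDef hm h0).eigenvalues_pos j).le, ← Real.sqrt_eq_rpow,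
      abs_mul, abs_of_nonneg (by positivity), mul_comm]
    gcongr
    exact Real.abs_sin_le_one _
  have hs : |(modes hm h0).s x * (modes hm h0).s y| ≤ 1 / (2 * mmin) := by
    rw [abs_of_pos (mul_pos ((modes hm h0).s_pos x) ((modes hm h0).s_pos y))]
    exact hb.sqrtMu_mul_sqrtMu_le hmmin x y
  have hkernel := enorm_mul_modes_kernel_rpow_le hm h0 hr hs
    (φ := fun w => w⁻¹ * Real.sin (2 * t * w)) hsin x y
  rw [mul_one] at hkernel
  rw [commNorm, ham_eq_closedOp_modes hm h0]
  exact (ENNReal.rpow_le_rpow ((modes hm h0).opENorm_pos_pos_le t x y) hr).trans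
    hkernel

theorem enorm_sqrtMu_div_mul_kernel_cos_rpow_le (u v : Fin d → ℤ) :
    ‖√(1 / (2 * p.m u)) / √(1 / (2 * p.m v)) *
      (modes (hb.m_pos hmmin) h0).kernel (fun w => Real.cos (2 * t * w)) x y‖ₑ ^ r ≤
    ‖√(1 / (2 * mmin)) / √(1 / (2 * mmax))‖ₑ ^ r * p.correlator 0 r L x y := by
  have hs : |√(1 / (2 * p.m u)) / √(1 / (2 * p.m v))| ≤ √(1 / (2 * mmin)) / √(1 / (2 * mmax)) := by
    rw [abs_of_nonneg (by positivity)]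
    exact hb.sqrtMu_div_sqrtMu_le hmmin u v
  have hcos (j : box d L) : |Real.cos (2 * t * √((p.h_isHermitian L).eigenvalues j))| ≤
      1 * (p.h_isHermitian L).eigenvalues j ^ (0 : ℝ) := by
    rw [Real.rpow_zero, mul_one]
    exact Real.abs_cos_le_one _
  simpa only [mul_one] using
    enorm_mul_modes_kernel_rpow_le (hb.m_pos hmmin) h0 hr hs
      (φ := fun w => Real.cos (2 * t * w)) hcos x y

theorem commNorm_mom_pos_rpow_le : p.commNorm L t (momOp x) (posOp y) ^ r ≤
    ‖√(1 / (2 * mmin)) / √(1 / (2 * mmax))‖ₑ ^ r * p.correlator 0 r L x y := by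
  have hm := hb.m_pos hmmin
  rw [commNorm, ham_eq_closedOp_modes hm h0]
  exact (ENNReal.rpow_le_rpow ((modes hm h0).opENorm_mom_pos_le t x y) hr).trans
    (hb.enorm_sqrtMu_div_mul_kernel_cos_rpow_le hmmin h0 x y t hr y x)

theorem commNorm_pos_mom_rpow_le : p.commNorm L t (posOp x) (momOp y) ^ r ≤
    ‖√(1 / (2 * mmin)) / √(1 / (2 * mmax))‖ₑ ^ r * p.correlator 0 r L x y := by
  have hm := hb.m_pos hmmin
  rw [commNorm, ham_eq_closedOp_modes hm h0]
  exact (ENNReal.rpow_le_rpow ((modes hm h0).opENorm_pos_mom_le t x y) hr).trans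
    (hb.enorm_sqrtMu_div_mul_kernel_cos_rpow_le hmmin h0 x y t hr x y)

theorem commNorm_mom_mom_rpow_le : p.commNorm L t (momOp x) (momOp y) ^ r ≤
    ‖2 * mmax * √(specBound d mmin kmax lammax)‖ₑ ^ r * p.correlator 0 r L x y := by
  have hm := hb.m_pos hmmin
  have hsin (j : box d L) : |√((p.h_isHermitian L).eigenvalues j) *
      Real.sin (2 * t * √((p.h_isHermitian L).eigenvalues j))| ≤
        √(specBound d mmin kmax lammax) * (p.h_isHermitian L).eigenvalues j ^ (0 : ℝ) := by
    rw [Real.rpow_zero, abs_mul, abs_of_nonneg (Real.sqrt_nonneg _)]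
    gcongr
    · exact hb.eigenvalues_h_le hmmin L j
    · exact Real.abs_sin_le_one _
  have hs : |((modes hm h0).s x * (modes hm h0).s y)⁻¹| ≤ 2 * mmax := by
    rw [abs_of_pos (inv_pos.2 (mul_pos ((modes hm h0).s_pos x) ((modes hm h0).s_pos y)))]
    exact hb.inv_sqrtMu_mul_sqrtMu_le hmmin x y
  rw [commNorm, ham_eq_closedOp_modes hm h0]
  exact (ENNReal.rpow_le_rpow ((modes hm h0).opENorm_mom_mom_le t x y) hr).trans
    (enorm_mul_modes_kernel_rpow_le hm h0 hr hs hsin x y)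

end Bounded

/-- The constant `K`, depending only on the bounds on the parameters, for which all commutator norms
involving a momentum operator are at most `K` times a correlator with exponent `α = 0`. -/
noncomputable def momConst (d : ℕ) (mmin mmax kmax lammax : ℝ) : ℝ≥0∞ :=
  max ‖√(1 / (2 * mmin)) / √(1 / (2 * mmax))‖ₑ ‖2 * mmax * √(specBound d mmin kmax lammax)‖ₑ

theorem momConst_ne_top (d : ℕ) (mmin mmax kmax lammax : ℝ) :
    momConst d mmin mmax kmax lammax ≠ ∞ :=
  max_ne_top enorm_ne_top enorm_ne_top

theorem Bounded.max_commNorm_rpow_le {mmin mmax kmax lammax : ℝ}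
    (hb : p.Bounded mmin mmax kmax lammax) (hmmin : 0 < mmin) {L : ℕ} (h0 : (p.h0 L).PosDef)
    (x y : box d L) (t : ℝ) {r : ℝ} (hr : 0 ≤ r) :
    max (p.commNorm L t (momOp x) (posOp y))
        (max (p.commNorm L t (posOp x) (momOp y)) (p.commNorm L t (momOp x) (momOp y))) ^ r ≤
      momConst d mmin mmax kmax lammax ^ r * p.correlator 0 r L x y := by
  have hmono := ENNReal.monotone_rpow_of_nonneg hr
  have hK : ∀ K ≤ momConst d mmin mmax kmax lammax, K ^ r * p.correlator 0 r L x y ≤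
      momConst d mmin mmax kmax lammax ^ r * p.correlator 0 r L x y :=
    fun K hK => mul_le_mul_left (hmono hK) _
  have hratio := hK _ (le_max_left _ _)
  rw [hmono.map_max, hmono.map_max]
  exact max_le ((hb.commNorm_mom_pos_rpow_le hmmin h0 x y t hr).trans hratio)
    (max_le ((hb.commNorm_pos_mom_rpow_le hmmin h0 x y t hr).trans hratio)
      ((hb.commNorm_mom_mom_rpow_le hmmin h0 x y t hr).trans (hK _ (le_max_right _ _))))

end OscParams

theorem ExpDecayInMean.of_le_const_mul {Ω : Type*} [MeasurableSpace Ω] {P : Measure Ω} {d : ℕ}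
    {F G : Ω → (L : ℕ) → box d L → box d L → ℝ≥0∞} {K : ℝ≥0∞} (hK : K ≠ ∞)
    (hF : ExpDecayInMean P F)
    (hGF : ∀ᵐ ω ∂P, ∀ L : ℕ, 1 ≤ L → ∀ x y, G ω L x y ≤ K * F ω L x y) :
    ExpDecayInMean P G := by
  obtain ⟨C, μ, hμ, hC⟩ := hF
  refine ⟨K.toReal * C, μ, hμ, fun L hL x y => ?_⟩
  calc ∫⁻ ω, G ω L x y ∂P ≤ ∫⁻ ω, K * F ω L x y ∂P :=
        lintegral_mono_ae (hGF.mono fun ω hω => hω L hL x y)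
    _ = K * ∫⁻ ω, F ω L x y ∂P := lintegral_const_mul' _ _ hK
    _ ≤ K * ENNReal.ofReal (C * Real.exp (-μ * dist1 (x : Fin d → ℤ) y)) := by
        gcongr
        exact hC L hL x y
    _ = ENNReal.ofReal (K.toReal * C * Real.exp (-μ * dist1 (x : Fin d → ℤ) y)) := by
        rw [mul_assoc, ENNReal.ofReal_mul ENNReal.toReal_nonneg, ENNReal.ofReal_toReal hK]

theorem theorem3p5_general {Ω : Type*} [MeasurableSpace Ω] (P : Measure Ω) (d : ℕ)
    (p : Ω → OscParams d) (mmin mmax kmax lammax : ℝ) (hmmin : 0 < mmin)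
    (hA1 : ∀ᵐ ω ∂P, (p ω).Bounded mmin mmax kmax lammax)
    (hA2 : ∀ᵐ ω ∂P, ∀ L : ℕ, 1 ≤ L → ((p ω).h0 L).PosDef) (r : ℝ) (hr : 0 ≤ r) :
    (ExpDecayInMean P (fun ω L x y => (p ω).correlator (-1 / 2) r L x y) →
      ExpDecayInMean P (fun ω L x y =>
        ⨆ t : ℝ, (p ω).commNorm L t (posOp x) (posOp y) ^ r)) ∧
    (ExpDecayInMean P (fun ω L x y => (p ω).correlator 0 r L x y) →
      ExpDecayInMean P (fun ω L x y =>
        ⨆ t : ℝ, max ((p ω).commNorm L t (momOp x) (posOp y))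
          (max ((p ω).commNorm L t (posOp x) (momOp y))
            ((p ω).commNorm L t (momOp x) (momOp y))) ^ r)) := by
  constructor <;> intro h
  · refine h.of_le_const_mul (K := ‖1 / (2 * mmin)‖ₑ ^ r)
      (ENNReal.rpow_ne_top_of_nonneg hr enorm_ne_top) ?_
    filter_upwards [hA1, hA2] with ω hb h0 L hL x y
    exact iSup_le fun t => hb.commNorm_pos_pos_rpow_le hmmin (h0 L hL) x y t hr
  · refine h.of_le_const_mul (ENNReal.rpow_ne_top_of_nonneg hr
      (OscParams.momConst_ne_top d mmin mmax kmax lammax)) ?_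
    filter_upwards [hA1, hA2] with ω hb h0 L hL x y
    exact iSup_le fun t => hb.max_commNorm_rpow_le hmmin (h0 L hL) x y t hr

theorem theorem3p5 {Ω : Type*} [MeasurableSpace Ω] (P : Measure Ω) [IsProbabilityMeasure P]
    (d : ℕ) (hd : 1 ≤ d) (p : Ω → OscParams d)
    (hm : ∀ x, Measurable fun ω => (p ω).m x)
    (hk : ∀ x, Measurable fun ω => (p ω).k x)
    (hlam : ∀ e, Measurable fun ω => (p ω).lam e)
    (mmin mmax kmax lammax : ℝ) (hmmin : 0 < mmin)
    (hA1 : ∀ᵐ ω ∂P, (p ω).Bounded mmin mmax kmax lammax)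
    (hA2 : ∀ᵐ ω ∂P, ∀ L : ℕ, 1 ≤ L → ((p ω).h0 L).PosDef) :
    (∀ r : ℝ, 0 < r → r ≤ 1 →
      ExpDecayInMean P (fun ω L x y => (p ω).correlator (-1 / 2) r L x y) →
      ExpDecayInMean P (fun ω L x y =>
        ⨆ t : ℝ, (p ω).commNorm L t (posOp x) (posOp y) ^ r)) ∧
    (ExpDecayInMean P (fun ω L x y => (p ω).correlator 0 1 L x y) →
      ExpDecayInMean P (fun ω L x y =>
        ⨆ t : ℝ, max ((p ω).commNorm L t (momOp x) (posOp y))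
          (max ((p ω).commNorm L t (posOp x) (momOp y))
            ((p ω).commNorm L t (momOp x) (momOp y))))) := by
  have hgeneral := theorem3p5_general P d p mmin mmax kmax lammax hmmin hA1 hA2
  exact ⟨fun r hr _ => (hgeneral r hr.le).1,
    by simpa only [ENNReal.rpow_one] using (hgeneral 1 zero_le_one).2⟩
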